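/- Let $k$ be a field and let $P$ be a (nonempty) finite connected poset with $n$ elements, where connected means that the Hasse diagram of $P$ is connected. By a $k[P]$-module we mean a finitely generated module over the incidence algebra of $P$, identified as usual with a functor $M$ from $P$ (viewed as a category) to finite-dimensional $k$-vector spaces. An interval of $P$ is a nonempty subset $I\subseteq P$ which is convex ($x,y\in I$ and $x<z<y$ imply $z\in I$) and connected as a poset with the induced order; its module $k_I$ has $(k_I)_a=k$ for $a\in I$ and $(k_I)_a=0$ otherwise, with $k_I(a\le b)=\mathrm{id}_k$ if $a,b\in I$ and $0$ otherwise. A module is called interval if it is isomorphic to some $k_I$, and interval-decomposable if it is isomorphic to a finite direct sum of modules $k_I$ (the empty sum being $0$). An interval cover of $M$ is a morphism $f\colon J\to M$ with $J$ interval-decomposable such that every morphism from an interval-decomposable module to $M$ factors through $f$, and such that every endomorphism $g$ of $J$ with $fg=f$ is an isomorphism. The interval resolution dimension of $M$ is the length of the minimal interval resolution of $M$, i.e. the least $m\ge 0$ for which there is an exact sequence $0\to J_m\to\cdots\to J_0\to M\to 0$ obtained by splicing interval covers of $M$ and of the successive kernels ($\infty$ if there is none), and the interval resolution global dimension of $k[P]$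 is the supremum of these dimensions over all $k[P]$-modules $M$. Then the following conditions are equivalent: (a) every $k[P]$-module is interval-decomposable; (b) every indecomposable $k[P]$-module is an interval module; (c) the interval resolution global dimension of $k[P]$ is $0$; (d) either the Hasse diagram of $P$ is the Dynkin diagram $A_n$, i.e. the path $1 - 2 - \cdots - n$, with some orientation of its edges, or $P$ is isomorphic to $C_{m,\ell}$ for some integers $m,\ell>0$ with $m+\ell=n-2$, where $C_{m,\ell}$ is obtained from the disjoint union of a chain with $m$ elements and a chain with $\ell$ elements by adding a global minimum $\hat 0$ and a global maximum $\hat 1$. In particular, these conditions do not depend on the field: if $k'$ is another field, then each of (a), (b), (c) holds for $k$ if and only if it holds for $k'$. -/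

import Mathlib

open CategoryTheory CategoryTheory.Limits

universe v u u₁ u₂ w

section RelativeResolutions

/-! ### Minimal approximations and resolution dimensions relative to a class of objects -/

variable {C : Type u} [Category.{v} C]

/-- `f : J ⟶ M` is right minimal: any endomorphism `g` of `J` with `f ∘ g = f` is an
isomorphism. -/
def IsRightMinimal {J M : C} (f : J ⟶ M) : Prop :=
  ∀ g : J ⟶ J, g ≫ f = f → IsIso g

/-- `f : J ⟶ M` is a right `𝒳`-approximation of `M`: `J` belongs to `𝒳`, and `Hom(Y, f)` is
surjective for all `Y` in `𝒳`. -/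
def IsRightApproximation (𝒳 : ObjectProperty C) {J M : C} (f : J ⟶ M) : Prop :=
  𝒳 J ∧ ∀ Y : C, 𝒳 Y → Function.Surjective (fun h : Y ⟶ J => h ≫ f)

/-- Right minimal `𝒳`-approximations. -/
def IsRightMinimalApproximation (𝒳 : ObjectProperty C) {J M : C} (f : J ⟶ M) : Prop :=
  IsRightApproximation 𝒳 f ∧ IsRightMinimal f

variable [HasZeroMorphisms C] [HasKernels C]

/-- `M` has a right minimal `𝒳`-resolution `0 ⟶ J_m ⟶ ⋯ ⟶ J_1 ⟶ J_0 ⟶ M ⟶ 0`, i.e. an exact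
sequence spliced from right minimal `𝒳`-approximations of `M` and of its successive syzygies
(the kernels of these approximations). The terms `J_i` are allowed to vanish. -/
def HasMinimalResolution (𝒳 : ObjectProperty C) : ℕ → C → Prop
  | 0, M => ∃ (J : C) (f : J ⟶ M), IsRightMinimalApproximation 𝒳 f ∧ IsIso f
  | m + 1, M => ∃ (J : C) (f : J ⟶ M), IsRightMinimalApproximation 𝒳 f ∧ Epi f ∧
      HasMinimalResolution 𝒳 m (kernel f)

/-- The `𝒳`-resolution dimension of `M`: the length of its right minimal `𝒳`-resolution (trailing
zero terms are not counted, whence the infimum), and `⊤` if there is no finite one. -/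
noncomputable def resolutionDim (𝒳 : ObjectProperty C) (M : C) : ℕ∞ :=
  ⨅ (m : ℕ) (_ : HasMinimalResolution 𝒳 m M), (m : ℕ∞)

/-- The `𝒳`-resolution global dimension: the supremum of the `𝒳`-resolution dimensions of all
objects. -/
noncomputable def resolutionGlobalDim (𝒳 : ObjectProperty C) : ℕ∞ :=
  ⨆ M : C, resolutionDim 𝒳 M

end RelativeResolutions

section PosetRepresentations

/-! ### Modules over the incidence algebra of a poset, and interval modules -/

/-- The category of finitely generated modules over the incidence algebra `k[P]` of a finite
poset `P`, realized as the category of (covariant) functors from `P` to finite dimensional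
`k`-vector spaces. -/
abbrev PosetRep (k : Type u) [Field k] (P : Type w) [PartialOrder P] :=
  P ⥤ FGModuleCat.{u} k

/-- An interval of a poset: a full subposet which is convex and connected (that is, its Hasse
diagram is connected, in particular it is nonempty). -/
structure IsPosetInterval {P : Type w} [PartialOrder P] (I : Set P) : Prop where
  convex : ∀ ⦃x y z : P⦄, x ∈ I → y ∈ I → x < z → z < y → z ∈ I
  connected : (SimpleGraph.hasse I).Connected

lemma IsPosetInterval.mem_of_le_of_le {P : Type w} [PartialOrder P] {I : Set P}
    (hI : IsPosetInterval I) {a b c : P} (ha : a ∈ I) (hc : c ∈ I) (hab : a ≤ b) (hbc : b ≤ c) :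
    b ∈ I := by
  rcases hab.eq_or_lt with rfl | hab
  · exact ha
  rcases hbc.eq_or_lt with rfl | hbc
  · exact hc
  exact hI.convex ha hc hab hbc

variable (k : Type u) [Field k] {P : Type w}

open Classical in
/-- The space `(k_I)_a`, which is `k` if `a ∈ I` and `0` otherwise (as a subspace of `k`). -/
noncomputable def intervalSpace (I : Set P) (a : P) : Submodule k k :=
  if a ∈ I then ⊤ else ⊥

open Classical in
/-- The map `k_I(a ≤ b)`, which is the identity of `k` if `a, b ∈ I` and `0` otherwise. -/
noncomputable def intervalMap (I : Set P) (a b : P) :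
    intervalSpace k I a →ₗ[k] intervalSpace k I b :=
  LinearMap.restrict (if a ∈ I ∧ b ∈ I then LinearMap.id else 0) (by
    intro x _
    by_cases h : a ∈ I ∧ b ∈ I
    · simp [intervalSpace, h.2]
    · rw [if_neg h]
      exact Submodule.zero_mem _)

open Classical in
lemma intervalMap_coe (I : Set P) (a b : P) (x : intervalSpace k I a) :
    (intervalMap k I a b x : k) = if a ∈ I ∧ b ∈ I then (x : k) else 0 := by
  unfold intervalMap
  split_ifs with h
  · simp [LinearMap.restrict_apply]
  · simp [LinearMap.restrict_apply]

lemma intervalSpace_eq_zero {I : Set P} {a : P} (ha : a ∉ I) (x : intervalSpace k I a) :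
    (x : k) = 0 := by
  have := x.2
  simpa [intervalSpace, ha] using this

variable [PartialOrder P]

instance : HasFiniteBiproducts (PosetRep k P) :=
  HasFiniteBiproducts.of_hasFiniteProducts

/-- The interval module `k_I` of an interval `I` of `P`. -/
noncomputable def intervalModule (I : Set P) (hI : IsPosetInterval I) : PosetRep k P where
  obj a := FGModuleCat.of k (intervalSpace k I a)
  map {a b} _ := FGModuleCat.ofHom (intervalMap k I a b)
  map_id a := by
    ext x
    refine (intervalMap_coe k I a a x).trans ?_
    by_cases ha : a ∈ I
    · simp [ha]
    · simpa [ha] using (intervalSpace_eq_zero k ha x).symm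
  map_comp {a b c} f g := by
    ext x
    refine (intervalMap_coe k I a c x).trans (Eq.symm ?_)
    refine (intervalMap_coe k I b c (intervalMap k I a b x)).trans ?_
    rw [intervalMap_coe]
    by_cases ha : a ∈ I <;> by_cases hc : c ∈ I
    · have hb : b ∈ I := hI.mem_of_le_of_le ha hc (leOfHom f) (leOfHom g)
      simp [ha, hb, hc]
    all_goals simp [ha, hc]

/-- `M` is an interval module: it is isomorphic to `k_I` for some interval `I` of `P`. -/
def IsIntervalModule (M : PosetRep k P) : Prop :=
  ∃ (I : Set P) (hI : IsPosetInterval I), Nonempty (M ≅ intervalModule k I hI)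

variable (P) in
/-- The class `add ℐ_P` of interval-decomposable modules: those isomorphic to a finite direct sum
of modules `k_I`, where `I` runs through intervals of `P` (repetitions are allowed, and the empty
direct sum is the zero module). -/
def IntervalDecomposable : ObjectProperty (PosetRep k P) := fun M =>
  ∃ (r : ℕ) (I : Fin r → {I : Set P // IsPosetInterval I}),
    Nonempty (M ≅ ⨁ fun i => intervalModule k (I i).1 (I i).2)

variable (P) in
/-- The interval resolution global dimension of `k[P]`. -/
noncomputable def intervalResolutionGlobalDim : ℕ∞ :=
  resolutionGlobalDim (IntervalDecomposable k P)

end PosetRepresentations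

section Classification

/-! ### The posets in the classification -/

/-- The Hasse diagram of `P` is the Dynkin diagram of type `A_n` (the path `1 — 2 — ⋯ — n`)
with some orientation. -/
def IsTypeA (P : Type w) [PartialOrder P] (n : ℕ) : Prop :=
  Nonempty (SimpleGraph.hasse P ≃g SimpleGraph.pathGraph n)

/-- The poset `C_{m,l}`: a global minimum and a global maximum added to the disjoint union of
a chain with `m` elements and a chain with `l` elements. -/
abbrev PosetC (m l : ℕ) := WithBot (WithTop (Fin m ⊕ Fin l))

end Classification

/-! Conditions (a), (b) and (c) are formally equivalent. Splitting off summands by induction on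
total dimension relates (a) to (b). A module has resolution dimension 0 exactly when its minimal
interval cover is an isomorphism, which gives (c). The content is that (a) is equivalent to the
combinatorial condition (d); independence of the field follows because (d) does not mention it.

From (d) to (a), it suffices to find one interval summand in every nonzero `M`. A summand `k_I`
amounts to compatible vectors `x a` and functionals `φ a` supported on `I` with `φ a (x a) = 1` on
`I` (`hasIntervalSummand_of_vectors`). For type A, and for any module supported on a convex zigzag,
both families are built from the first nonzero vertex: subspaces further along are transported back
to it as for linear relations, and the interval stops where the transports of the whole space and of
zero cease to be separated (`hasIntervalSummand_of_zigzag`). For `C_{m,l}` there are three cases. If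
`M` vanishes at the minimum, it lives on a zigzag. If the map from minimum to maximum is nonzero,
`k_P` splits off. Otherwise a minimal choice among the kernels of the maps out of the minimum yields
a summand supported on a down-set (`hasIntervalSummand_of_diamond`).

From (a) to (d), two obstructions are used. A vertex of degree at least three in the Hasse diagram
carries a representation whose endomorphisms preserve three distinct lines of a plane. So the
connected diagram is a path or a cycle. In a cycle, take a maximal element and its two lower covers:
if these have no common lower bound, a Jordan block can be inserted as monodromy; if they have one,
the poset is some `C_{m,l}`. -/

/-! ### Direct summands in additive categories -/

section Splitting

variable {C : Type u} [Category.{v} C] [Preadditive C] [HasFiniteBiproducts C]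
  [HasBinaryBiproducts C]

/-- A split epimorphism splits off its target as a direct summand. -/
noncomputable def isoBiprodKernelOfRetract [HasKernels C] {X M : C} (i : X ⟶ M) (p : M ⟶ X)
    (h : i ≫ p = 𝟙 X) : M ≅ X ⊞ kernel p where
  hom := biprod.lift p (kernel.lift p (𝟙 M - p ≫ i) (by simp [h]))
  inv := biprod.desc i (kernel.ι p)
  hom_inv_id := by simp [biprod.lift_desc]
  inv_hom_id := by
    ext <;> simp [h, reassoc_of% h]

/-- Splitting off the first summand of a finite biproduct. -/
noncomputable def biprodBiproductSuccIso {r : ℕ} (f : Fin (r + 1) → C) :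
    (f 0 ⊞ ⨁ fun i : Fin r => f i.succ) ≅ ⨁ f where
  hom := biprod.desc (biproduct.ι f 0) (biproduct.desc fun i => biproduct.ι f i.succ)
  inv := biprod.lift (biproduct.π f 0) (biproduct.lift fun i => biproduct.π f i.succ)
  hom_inv_id := by
    ext j
    · simp
    · simp [biproduct.ι_π_ne f (Fin.succ_ne_zero j).symm]
    · simp [biproduct.ι_π_ne f (Fin.succ_ne_zero _)]
    · rename_i j i
      by_cases hij : j = i
      · subst hij; simp
      · have : j.succ ≠ i.succ := fun h => hij (Fin.succ_injective _ h)
        simp [biproduct.ι_π_ne f this, biproduct.ι_π_ne _ hij]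
  inv_hom_id := by
    rw [biprod.lift_desc, biproduct.lift_desc, ← biproduct.total, Fin.sum_univ_succ]

end Splitting

/-! ### Representations in terms of linear maps -/

section Basic

variable {k : Type u} [Field k] {P : Type w} [PartialOrder P]

namespace PosetRep

/-- The structure map of a representation, as a linear map. -/
def lin (M : PosetRep k P) {a b : P} (h : a ≤ b) : M.obj a →ₗ[k] M.obj b :=
  (M.map (homOfLE h)).hom.hom

@[simp]
lemma lin_refl (M : PosetRep k P) (a : P) (x : M.obj a) : M.lin (le_refl a) x = x := by
  simp [lin]

@[simp]
lemma lin_lin (M : PosetRep k P) {a b c : P} (h : a ≤ b) (h' : b ≤ c) (x : M.obj a) :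
    M.lin h' (M.lin h x) = M.lin (h.trans h') x := by
  have : M.map (homOfLE (h.trans h')) = M.map (homOfLE h) ≫ M.map (homOfLE h') := by
    rw [← M.map_comp]; rfl
  simp [lin, this]

/-- The component of a morphism of representations, as a linear map. -/
def appLin {M N : PosetRep k P} (f : M ⟶ N) (a : P) : M.obj a →ₗ[k] N.obj a :=
  (f.app a).hom.hom

lemma appLin_naturality {M N : PosetRep k P} (f : M ⟶ N) {a b : P} (h : a ≤ b) (x : M.obj a) :
    appLin f b (M.lin h x) = N.lin h (appLin f a x) := by
  have := congrArg (fun g => g.hom.hom x) (f.naturality (homOfLE h))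
  exact this

@[simp]
lemma appLin_comp {M N L : PosetRep k P} (f : M ⟶ N) (g : N ⟶ L) (a : P) (x : M.obj a) :
    appLin (f ≫ g) a x = appLin g a (appLin f a x) := rfl

@[simp]
lemma appLin_id (M : PosetRep k P) (a : P) (x : M.obj a) : appLin (𝟙 M) a x = x := rfl

@[simp]
lemma appLin_zero (M N : PosetRep k P) (a : P) (x : M.obj a) :
    appLin (0 : M ⟶ N) a x = 0 := rfl

lemma appLin_add {M N : PosetRep k P} (f g : M ⟶ N) (a : P) :
    appLin (f + g) a = appLin f a + appLin g a := rfl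

lemma appLin_sum {M N : PosetRep k P} {ι : Type*} (s : Finset ι) (f : ι → (M ⟶ N)) (a : P) :
    appLin (∑ i ∈ s, f i) a = ∑ i ∈ s, appLin (f i) a := by
  classical
  induction s using Finset.induction_on with
  | empty => rfl
  | insert i s hi ih => rw [Finset.sum_insert hi, Finset.sum_insert hi, appLin_add, ih]

lemma hom_ext {M N : PosetRep k P} {f g : M ⟶ N} (h : ∀ a x, appLin f a x = appLin g a x) :
    f = g := by
  ext a x
  exact h a x

/-- A representation is zero iff all its spaces are. -/
lemma isZero_iff (M : PosetRep k P) : IsZero M ↔ ∀ a (x : M.obj a), x = 0 := by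
  rw [IsZero.iff_id_eq_zero]
  constructor
  · intro h a x
    rw [← appLin_id M a x, h, appLin_zero]
  · intro h
    exact hom_ext fun a x => by rw [appLin_id, appLin_zero, h a x]

lemma exists_ne_zero {M : PosetRep k P} (h : ¬ IsZero M) : ∃ a, ∃ x : M.obj a, x ≠ 0 := by
  rw [isZero_iff] at h
  push Not at h
  exact h

/-- The morphism of representations with given linear components. -/
def homMk {M N : PosetRep k P} (f : ∀ a, M.obj a →ₗ[k] N.obj a)
    (h : ∀ a b (hab : a ≤ b) (x : M.obj a), f b (M.lin hab x) = N.lin hab (f a x)) : M ⟶ N where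
  app a := FGModuleCat.ofHom (f a)
  naturality a b g := by
    ext x
    exact h a b (leOfHom g) x

/-- The representation with given finite dimensional spaces and linear maps. -/
def mk (V : P → Type u) [∀ a, AddCommGroup (V a)] [∀ a, Module k (V a)]
    [∀ a, Module.Finite k (V a)] (f : ∀ {a b : P}, a ≤ b → (V a →ₗ[k] V b))
    (hid : ∀ a x, f (le_refl a) x = x)
    (hcomp : ∀ {a b c : P} (h : a ≤ b) (h' : b ≤ c) x, f h' (f h x) = f (h.trans h') x) :
    PosetRep k P where
  obj a := FGModuleCat.of k (V a)
  map g := FGModuleCat.ofHom (f (leOfHom g))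
  map_id a := by
    ext x
    exact hid a x
  map_comp g g' := by
    ext x
    exact (hcomp (leOfHom g) (leOfHom g') x).symm

/-- The total dimension of a representation. -/
noncomputable def dim (M : PosetRep k P) : ℕ := ∑ᶠ a, Module.finrank k (M.obj a)

lemma dim_lt_of_biprod [Finite P] {M Y Z : PosetRep k P} (e : M ≅ Y ⊞ Z) (hY : ¬ IsZero Y) :
    dim Z < dim M := by
  cases nonempty_fintype P
  set i : Z ⟶ M := biprod.inr ≫ e.inv
  set p : M ⟶ Z := e.hom ≫ biprod.snd
  set j : Y ⟶ M := biprod.inl ≫ e.inv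
  set q : M ⟶ Y := e.hom ≫ biprod.fst
  have hp : i ≫ p = 𝟙 Z := by simp [i, p]
  have hq : j ≫ q = 𝟙 Y := by simp [j, q]
  have hjp : j ≫ p = 0 := by simp [j, p]
  have hsurj : ∀ a, Function.Surjective (appLin p a) := fun a x =>
    ⟨appLin i a x, by rw [← appLin_comp, hp, appLin_id]⟩
  have hle : ∀ a, Module.finrank k (Z.obj a) ≤ Module.finrank k (M.obj a) := fun a =>
    LinearMap.finrank_le_finrank_of_surjective (hsurj a)
  rw [dim, dim, finsum_eq_sum_of_fintype, finsum_eq_sum_of_fintype]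
  obtain ⟨a, y, hy⟩ := exists_ne_zero hY
  refine Finset.sum_lt_sum (fun a _ => hle a) ⟨a, Finset.mem_univ _, (hle a).lt_of_ne fun heq => ?_⟩
  -- Equal dimensions would make the projection to `Z` injective at `a`, yet it kills the nonzero
  -- image of `y`.
  have hinj : Function.Injective (appLin p a) :=
    (LinearMap.injective_iff_surjective_of_finrank_eq_finrank heq.symm).2 (hsurj a)
  apply hy
  have h0 : appLin j a y = 0 := hinj (by rw [← appLin_comp, hjp, appLin_zero, map_zero])
  rw [← appLin_id Y a y, ← hq, appLin_comp, h0, map_zero]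

end PosetRep

end Basic

/-! ### Interval summands and the equivalence of (a) and (b) -/

section IntervalSummands

open PosetRep

variable {k : Type u} [Field k] {P : Type w} [PartialOrder P]

/-- The generator of `k_I` at a point of `I`. -/
def intervalGen (I : Set P) {a : P} (ha : a ∈ I) : intervalSpace k I a :=
  ⟨1, by simp [intervalSpace, ha]⟩

lemma intervalModule_not_isZero (I : Set P) (hI : IsPosetInterval I) :
    ¬ IsZero (intervalModule k I hI) := by
  obtain ⟨a, ha⟩ := hI.connected.nonempty
  rw [isZero_iff]
  intro h
  have := congrArg (Subtype.val) (h a (intervalGen I ha))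
  exact one_ne_zero (α := k) this

open Classical in
lemma intervalModule_lin_coe (I : Set P) (hI : IsPosetInterval I) {a b : P} (h : a ≤ b)
    (x : intervalSpace k I a) :
    Subtype.val (p := (· ∈ intervalSpace k I b)) ((intervalModule k I hI).lin h x)
      = if a ∈ I ∧ b ∈ I then (x : k) else 0 :=
  intervalMap_coe k I a b x

/-- The morphism `k_I ⟶ M` given by a compatible family of vectors. -/
noncomputable def homOfVectors (I : Set P) (hI : IsPosetInterval I) (M : PosetRep k P)
    (x : ∀ a, M.obj a) (hx0 : ∀ a, a ∉ I → x a = 0)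
    (hx : ∀ a b (h : a ≤ b), a ∈ I → M.lin h (x a) = x b) :
    intervalModule k I hI ⟶ M :=
  homMk (fun a => (LinearMap.toSpanSingleton k (M.obj a) (x a)).comp (intervalSpace k I a).subtype)
    (by
      classical
      intro a b hab (y : intervalSpace k I a)
      change Subtype.val (p := (· ∈ intervalSpace k I b)) ((intervalModule k I hI).lin hab y) • x b
        = M.lin hab ((y : k) • x a)
      rw [intervalModule_lin_coe, map_smul]
      by_cases ha : a ∈ I
      · by_cases hb : b ∈ I
        · rw [if_pos ⟨ha, hb⟩, hx a b hab ha]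
        · rw [hx a b hab ha, hx0 b hb, smul_zero, smul_zero]
      · rw [if_neg (fun h => ha h.1), intervalSpace_eq_zero k ha y, zero_smul, zero_smul])

/-- The morphism `M ⟶ k_I` given by a compatible family of functionals. -/
noncomputable def homOfFunctionals (I : Set P) (hI : IsPosetInterval I) (M : PosetRep k P)
    (φ : ∀ a, M.obj a →ₗ[k] k) (hφ0 : ∀ a, a ∉ I → φ a = 0)
    (hφ : ∀ a b (h : a ≤ b), b ∈ I → φ b ∘ₗ M.lin h = φ a) :
    M ⟶ intervalModule k I hI :=
  homMk (N := intervalModule k I hI)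
    (fun a => LinearMap.codRestrict (intervalSpace k I a) (φ a) (by
      intro y
      by_cases ha : a ∈ I
      · simp [intervalSpace, ha]
      · rw [hφ0 a ha]; exact Submodule.zero_mem _))
    (by
      classical
      intro a b hab y
      refine Subtype.ext (Eq.trans ?_ (intervalModule_lin_coe I hI hab _).symm)
      change φ b (M.lin hab y) = if a ∈ I ∧ b ∈ I then φ a y else 0
      by_cases hb : b ∈ I
      · rw [← LinearMap.comp_apply, hφ a b hab hb]
        by_cases ha : a ∈ I
        · rw [if_pos ⟨ha, hb⟩]
        · rw [if_neg (fun h => ha h.1), hφ0 a ha, LinearMap.zero_apply]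
      · rw [if_neg (fun h => hb h.2), hφ0 b hb, LinearMap.zero_apply])

/-- `M` has a direct summand which is an interval module. -/
def HasIntervalSummand (M : PosetRep k P) : Prop :=
  ∃ (I : Set P) (hI : IsPosetInterval I) (i : intervalModule k I hI ⟶ M)
    (p : M ⟶ intervalModule k I hI), i ≫ p = 𝟙 _

/-- The vectors define a map `k_I ⟶ M`, the functionals a map back, and the composite is
multiplication by `φ a (x a) = 1` at each point of `I`. For `b ∉ I`, condition `hx` says that the
vectors die on leaving `I`; dually, `hφ` says that the functionals kill whatever enters `I` from
outside. -/
lemma hasIntervalSummand_of_vectors {I : Set P} (hI : IsPosetInterval I) {M : PosetRep k P}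
    (x : ∀ a, M.obj a) (φ : ∀ a, M.obj a →ₗ[k] k)
    (hx0 : ∀ a, a ∉ I → x a = 0) (hx : ∀ a b (h : a ≤ b), a ∈ I → M.lin h (x a) = x b)
    (hφ0 : ∀ a, a ∉ I → φ a = 0) (hφ : ∀ a b (h : a ≤ b), b ∈ I → φ b ∘ₗ M.lin h = φ a)
    (h1 : ∀ a ∈ I, φ a (x a) = 1) : HasIntervalSummand M := by
  refine ⟨I, hI, homOfVectors I hI M x hx0 hx, homOfFunctionals I hI M φ hφ0 hφ,
    hom_ext fun a (y : intervalSpace k I a) => Subtype.ext ?_⟩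
  change φ a ((y : k) • x a) = (y : k)
  by_cases ha : a ∈ I
  · rw [map_smul, h1 a ha, smul_eq_mul, mul_one]
  · rw [hφ0 a ha, intervalSpace_eq_zero k ha y, LinearMap.zero_apply]

lemma HasIntervalSummand.of_retract {M N : PosetRep k P} (h : HasIntervalSummand N)
    (i : N ⟶ M) (p : M ⟶ N) (hip : i ≫ p = 𝟙 N) : HasIntervalSummand M := by
  obtain ⟨I, hI, j, q, hjq⟩ := h
  refine ⟨I, hI, j ≫ i, p ≫ q, ?_⟩
  rw [Category.assoc, reassoc_of% hip, hjq]

lemma HasIntervalSummand.exists_iso {M : PosetRep k P} (h : HasIntervalSummand M) :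
    ∃ (I : Set P) (hI : IsPosetInterval I) (N : PosetRep k P),
      Nonempty (M ≅ intervalModule k I hI ⊞ N) := by
  obtain ⟨I, hI, i, p, hip⟩ := h
  exact ⟨I, hI, _, ⟨isoBiprodKernelOfRetract i p hip⟩⟩

lemma HasIntervalSummand.isIntervalModule {M : PosetRep k P} (h : HasIntervalSummand M)
    (hM : Indecomposable M) : IsIntervalModule k M := by
  obtain ⟨I, hI, N, ⟨e⟩⟩ := h.exists_iso
  have hN : IsZero N := (hM.2 _ _ e).resolve_left (intervalModule_not_isZero I hI)
  exact ⟨I, hI, ⟨e ≪≫ (isoBiprodZero hN).symm⟩⟩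

lemma IntervalDecomposable.hasIntervalSummand {M : PosetRep k P}
    (h : IntervalDecomposable k P M) (hM : ¬ IsZero M) : HasIntervalSummand M := by
  obtain ⟨r, I, ⟨e⟩⟩ := h
  cases r with
  | zero =>
    refine absurd ?_ hM
    refine IsZero.of_iso ?_ e
    rw [IsZero.iff_id_eq_zero]
    exact biproduct.hom_ext _ _ fun j => j.elim0
  | succ r =>
    exact ⟨_, (I 0).2, biproduct.ι (fun i => intervalModule k (I i).1 (I i).2) 0 ≫ e.inv,
      e.hom ≫ biproduct.π _ 0, by simp⟩

/-- The components of a direct sum decomposition, as endomorphisms. -/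
lemma IntervalDecomposable.exists_endomorphisms {M : PosetRep k P}
    (h : IntervalDecomposable k P M) :
    ∃ (r : ℕ) (I : Fin r → {I : Set P // IsPosetInterval I})
      (i : ∀ s, intervalModule k (I s).1 (I s).2 ⟶ M)
      (p : ∀ s, M ⟶ intervalModule k (I s).1 (I s).2), ∑ s, p s ≫ i s = 𝟙 M := by
  obtain ⟨r, I, ⟨e⟩⟩ := h
  refine ⟨r, I, fun s => biproduct.ι (fun i => intervalModule k (I i).1 (I i).2) s ≫ e.inv,
    fun s => e.hom ≫ biproduct.π _ s, ?_⟩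
  have : ∀ s : Fin r, (e.hom ≫ biproduct.π (fun i => intervalModule k (I i).1 (I i).2) s) ≫
      biproduct.ι (fun i => intervalModule k (I i).1 (I i).2) s ≫ e.inv =
      e.hom ≫ (biproduct.π (fun i => intervalModule k (I i).1 (I i).2) s ≫
      biproduct.ι (fun i => intervalModule k (I i).1 (I i).2) s) ≫ e.inv := by simp
  simp_rw [this]
  rw [← Preadditive.comp_sum, ← Preadditive.sum_comp, biproduct.total]
  simp

lemma IntervalDecomposable.biprod {I : Set P} {hI : IsPosetInterval I} {M N : PosetRep k P}
    (e : M ≅ intervalModule k I hI ⊞ N) (h : IntervalDecomposable k P N) :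
    IntervalDecomposable k P M := by
  obtain ⟨r, J, ⟨e'⟩⟩ := h
  let K : Fin (r + 1) → {I : Set P // IsPosetInterval I} := Fin.cons ⟨I, hI⟩ J
  exact ⟨r + 1, K, ⟨e ≪≫ biprod.mapIso (Iso.refl _) e' ≪≫
    biprodBiproductSuccIso (fun s => intervalModule k (K s).1 (K s).2)⟩⟩

lemma intervalDecomposable_of_isZero {M : PosetRep k P} (h : IsZero M) :
    IntervalDecomposable k P M := by
  refine ⟨0, Fin.elim0, ⟨h.iso ?_⟩⟩
  rw [IsZero.iff_id_eq_zero]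
  exact biproduct.hom_ext _ _ fun j => j.elim0

/-- The complement of a split interval has smaller total dimension, so splitting terminates. -/
lemma intervalDecomposable_of_hasIntervalSummand [Finite P]
    (h : ∀ M : PosetRep k P, ¬ IsZero M → HasIntervalSummand M) (M : PosetRep k P) :
    IntervalDecomposable k P M := by
  induction hd : dim M using Nat.strong_induction_on generalizing M with
  | _ d ih =>
    by_cases hM : IsZero M
    · exact intervalDecomposable_of_isZero hM
    obtain ⟨I, hI, N, ⟨e⟩⟩ := (h M hM).exists_iso
    exact .biprod e (ih _ (hd ▸ dim_lt_of_biprod e (intervalModule_not_isZero I hI)) N rfl)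

/-- A decomposable module has a nonzero proper summand of smaller dimension, and an interval summand
of that one is a summand of the whole; no uniqueness of decompositions is needed. -/
lemma hasIntervalSummand_of_indecomposable [Finite P]
    (h : ∀ M : PosetRep k P, Indecomposable M → IsIntervalModule k M) (M : PosetRep k P)
    (hM : ¬ IsZero M) : HasIntervalSummand M := by
  induction hd : dim M using Nat.strong_induction_on generalizing M with
  | _ d ih =>
    by_cases hi : Indecomposable M
    · obtain ⟨I, hI, ⟨e⟩⟩ := h M hi
      exact ⟨I, hI, e.inv, e.hom, e.inv_hom_id⟩
    · rw [Indecomposable] at hi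
      push Not at hi
      obtain ⟨Y, Z, e, hY, hZ⟩ := hi hM
      exact (ih _ (hd ▸ dim_lt_of_biprod e hY) Z hZ rfl).of_retract (biprod.inr ≫ e.inv)
        (e.hom ≫ biprod.snd) (by simp)

theorem forall_intervalDecomposable_iff_indecomposable [Finite P] :
    (∀ M : PosetRep k P, IntervalDecomposable k P M) ↔
      ∀ M : PosetRep k P, Indecomposable M → IsIntervalModule k M :=
  ⟨fun h M hM => ((h M).hasIntervalSummand hM.1).isIntervalModule hM,
    fun h => intervalDecomposable_of_hasIntervalSummand (hasIntervalSummand_of_indecomposable h)⟩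

end IntervalSummands

/-! ### Vanishing of the resolution dimension -/

section GlobalDimension

variable {C : Type u} [Category.{v} C] [HasZeroMorphisms C] [HasKernels C]

/-- The identity of an object of `𝒳` is a right minimal approximation. Conversely the infimum can be
0 only if a resolution of length 0 exists, that is, if some approximation is an isomorphism. -/
lemma resolutionDim_eq_zero_iff (𝒳 : ObjectProperty C) [𝒳.IsClosedUnderIsomorphisms] (M : C) :
    resolutionDim 𝒳 M = 0 ↔ 𝒳 M := by
  constructor
  · intro h
    have h0 : HasMinimalResolution 𝒳 0 M := by
      by_contra h0
      have : (1 : ℕ∞) ≤ resolutionDim 𝒳 M := by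
        refine le_iInf₂ fun m hm => ?_
        cases m with
        | zero => exact absurd hm h0
        | succ m => simp
      simp [h] at this
    obtain ⟨J, f, hf, _⟩ := h0
    exact 𝒳.prop_of_iso (asIso f) hf.1.1
  · intro h
    refine le_antisymm (iInf₂_le_of_le 0 ?_ le_rfl) zero_le
    refine ⟨M, 𝟙 M, ⟨⟨h, fun Y _ g => ⟨g, by simp⟩⟩, fun g hg => ?_⟩, inferInstance⟩
    have : g = 𝟙 M := by simpa using hg
    rw [this]
    infer_instance

lemma resolutionGlobalDim_eq_zero_iff (𝒳 : ObjectProperty C) [𝒳.IsClosedUnderIsomorphisms] :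
    resolutionGlobalDim 𝒳 = 0 ↔ ∀ M, 𝒳 M := by
  simp only [resolutionGlobalDim, ← bot_eq_zero, iSup_eq_bot]
  simp only [bot_eq_zero, resolutionDim_eq_zero_iff]

end GlobalDimension

instance (k : Type u) [Field k] (P : Type w) [PartialOrder P] :
    (IntervalDecomposable k P).IsClosedUnderIsomorphisms where
  of_iso := by
    rintro M N e ⟨r, I, ⟨e'⟩⟩
    exact ⟨r, I, ⟨e.symm ≪≫ e'⟩⟩

/-! ### Auxiliary facts on Hasse diagrams and on extending functionals -/

section HasseReachability

lemma SimpleGraph.hasse_reachable_of_le {Q : Type*} [PartialOrder Q] [Finite Q] {x y : Q}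
    (h : x ≤ y) : (SimpleGraph.hasse Q).Reachable x y := by
  classical
  cases nonempty_fintype Q
  let _ : LocallyFiniteOrder Q := Fintype.toLocallyFiniteOrder
  rw [le_iff_reflTransGen_covBy] at h
  rw [SimpleGraph.reachable_iff_reflTransGen]
  exact Relation.ReflTransGen.mono (fun a b hab => Or.inl hab) _ _ h

end HasseReachability

section LinearExtensions

variable {k V W : Type*} [Field k] [AddCommGroup V] [Module k V] [AddCommGroup W] [Module k W]

/-- A functional vanishing on the preimage of `E` extends along `f` to one vanishing on `E`. -/
lemma LinearMap.exists_comp_eq_of_comap_le_ker (f : V →ₗ[k] W) (E : Submodule k W) (φ : V →ₗ[k] k)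
    (h : E.comap f ≤ LinearMap.ker φ) : ∃ ψ : W →ₗ[k] k, ψ ∘ₗ f = φ ∧ E ≤ LinearMap.ker ψ := by
  -- The induced map of quotients is injective, so `φ` extends along it through a left inverse.
  let g : (V ⧸ E.comap f) →ₗ[k] (W ⧸ E) := Submodule.mapQ _ _ f le_rfl
  have hg : LinearMap.ker g = ⊥ := by
    rw [LinearMap.ker_eq_bot']
    intro x
    induction x using Submodule.Quotient.induction_on with
    | _ x =>
      intro hx
      rw [Submodule.mapQ_apply, Submodule.Quotient.mk_eq_zero] at hx
      rwa [Submodule.Quotient.mk_eq_zero]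
  obtain ⟨r, hr⟩ := LinearMap.exists_leftInverse_of_injective g hg
  refine ⟨(Submodule.liftQ _ φ h) ∘ₗ r ∘ₗ E.mkQ, ?_, ?_⟩
  · ext x
    have := LinearMap.congr_fun hr (Submodule.Quotient.mk x)
    simp only [LinearMap.comp_apply, LinearMap.id_apply, g, Submodule.mapQ_apply] at this
    simp [this]
  · intro x hx
    have : E.mkQ x = 0 := by simpa using hx
    simp [this]

lemma Submodule.exists_functional_eq_one (E : Submodule k V) {x : V} (hx : x ∉ E) :
    ∃ φ : V →ₗ[k] k, E ≤ LinearMap.ker φ ∧ φ x = 1 := by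
  obtain ⟨φ, hφ, hE⟩ := Submodule.exists_le_ker_of_notMem hx
  refine ⟨(φ x)⁻¹ • φ, fun y hy => ?_, ?_⟩
  · have : φ y = 0 := hE hy
    simp [this]
  · simp [inv_mul_cancel₀ hφ]

end LinearExtensions

/-! ### Interval summands over zigzags -/

section Zigzag

open PosetRep

variable {k : Type u} [Field k] {P : Type w} [PartialOrder P]

/-- The points `v 0, …, v (n - 1)` form a convex zigzag in a poset. -/
structure IsZigzag (v : ℕ → P) (n : ℕ) : Prop where
  inj : ∀ ⦃a b⦄, a < n → b < n → v a = v b → a = b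
  comparable : ∀ ⦃i⦄, i + 1 < n → v i ≤ v (i + 1) ∨ v (i + 1) ≤ v i
  between : ∀ ⦃a b r⦄, a < n → b < n → v a ≤ v b → (a ≤ r ∧ r ≤ b ∨ b ≤ r ∧ r ≤ a) →
    v a ≤ v r ∧ v r ≤ v b
  convex : ∀ ⦃a b z⦄, a < n → b < n → v a ≤ z → z ≤ v b →
    ∃ c, (a ≤ c ∧ c ≤ b ∨ b ≤ c ∧ c ≤ a) ∧ v c = z

variable {v : ℕ → P} {n : ℕ}

lemma IsZigzag.shift (h : IsZigzag v n) (m : ℕ) : IsZigzag (fun i => v (m + i)) (n - m) where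
  inj a b ha hb hab := by
    have := h.inj (by omega) (by omega) hab
    omega
  comparable i hi := h.comparable (by omega)
  between a b r ha hb hab hr := h.between (by omega) (by omega) hab (by omega)
  convex a b z ha hb haz hzb := by
    obtain ⟨c, hc, rfl⟩ := h.convex (by omega) (by omega) haz hzb
    refine ⟨c - m, by omega, ?_⟩
    congr 1
    omega

lemma IsZigzag.isPosetInterval (h : IsZigzag v n) {j : ℕ} (hj : j < n) :
    IsPosetInterval (v '' Set.Iic j) where
  convex := by
    rintro _ _ z ⟨a, ha, rfl⟩ ⟨b, hb, rfl⟩ haz hzb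
    simp only [Set.mem_Iic] at ha hb
    obtain ⟨c, hc, rfl⟩ := h.convex (ha.trans_lt hj) (hb.trans_lt hj) haz.le hzb.le
    exact ⟨c, Set.mem_Iic.2 (by omega), rfl⟩
  connected := by
    have : Finite (v '' Set.Iic j) := ((Set.finite_Iic j).image v).to_subtype
    have key : ∀ i (hi : i ≤ j), (SimpleGraph.hasse (v '' Set.Iic j)).Reachable
        ⟨v 0, 0, Nat.zero_le j, rfl⟩ ⟨v i, i, hi, rfl⟩ := by
      intro i
      induction i with
      | zero => exact fun _ => .rfl
      | succ i ih =>
        intro hi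
        refine (ih (by omega)).trans ?_
        rcases h.comparable (i := i) (by omega) with h' | h'
        · exact SimpleGraph.hasse_reachable_of_le h'
        · exact (SimpleGraph.hasse_reachable_of_le (Q := v '' Set.Iic j) h').symm
    have : Nonempty (v '' Set.Iic j) := ⟨⟨v 0, 0, Nat.zero_le j, rfl⟩⟩
    refine ⟨?_⟩
    rintro ⟨_, a, ha, rfl⟩ ⟨_, b, hb, rfl⟩
    exact (key a ha).symm.trans (key b hb)

namespace PosetRep

variable (M : PosetRep k P)

/-- Compatibility of a family of vectors along the `i`-th edge of a zigzag. -/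
def CompatAt (v : ℕ → P) (x : ∀ a, M.obj a) (i : ℕ) : Prop :=
  (∀ h : v i ≤ v (i + 1), M.lin h (x (v i)) = x (v (i + 1))) ∧
    ∀ h : v (i + 1) ≤ v i, M.lin h (x (v (i + 1))) = x (v i)

/-- Compatibility of a family of functionals along the `i`-th edge of a zigzag. -/
def CocompatAt (v : ℕ → P) (φ : ∀ a, M.obj a →ₗ[k] k) (i : ℕ) : Prop :=
  (∀ h : v i ≤ v (i + 1), φ (v (i + 1)) ∘ₗ M.lin h = φ (v i)) ∧
    ∀ h : v (i + 1) ≤ v i, φ (v i) ∘ₗ M.lin h = φ (v (i + 1))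

open Classical in
/-- The subspace of `M_{v i}` related to a subspace of `M_{v (i+1)}`. -/
noncomputable def pull (v : ℕ → P) (i : ℕ) (E : Submodule k (M.obj (v (i + 1)))) :
    Submodule k (M.obj (v i)) :=
  if h : v i ≤ v (i + 1) then E.comap (M.lin h)
  -- The final `⊥` is a default value: consecutive points of a zigzag are comparable.
  else if h : v (i + 1) ≤ v i then E.map (M.lin h) else ⊥

/-- The subspace of `M_{v 0}` related to a subspace of `M_{v j}` along the zigzag. -/
noncomputable def pullZero (v : ℕ → P) :
    (j : ℕ) → Submodule k (M.obj (v j)) → Submodule k (M.obj (v 0))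
  | 0, E => E
  | j + 1, E => pullZero v j (M.pull v j E)

variable {M}

/-- Compatibility along edges suffices, since by `between` a relation `v a ≤ v b` factors through
every intermediate vertex. -/
lemma lin_zigzag (hv : IsZigzag v n) {x : ∀ a, M.obj a} {j : ℕ} (hj : j < n)
    (hx : ∀ i < j, M.CompatAt v x i) {a b : ℕ} (ha : a ≤ j) (hb : b ≤ j) (hab : v a ≤ v b) :
    M.lin hab (x (v a)) = x (v b) := by
  rcases le_total a b with h | h
  · induction b, h using Nat.le_induction with
    | base => exact M.lin_refl _ _
    | succ b h ih =>
      have h1 := hv.between (r := b) (by omega) (by omega) hab (by omega)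
      rw [← M.lin_lin h1.1 h1.2, ih (by omega), (hx b (by omega)).1]
  · induction a, h using Nat.le_induction with
    | base => exact M.lin_refl _ _
    | succ a h ih =>
      have h1 := hv.between (r := a) (by omega) (by omega) hab (by omega)
      rw [← M.lin_lin h1.1 h1.2, (hx a (by omega)).2, ih (by omega)]

lemma comp_lin_zigzag (hv : IsZigzag v n) {φ : ∀ a, M.obj a →ₗ[k] k} {j : ℕ} (hj : j < n)
    (hφ : ∀ i < j, M.CocompatAt v φ i) {a b : ℕ} (ha : a ≤ j) (hb : b ≤ j) (hab : v a ≤ v b)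
    (y : M.obj (v a)) : φ (v b) (M.lin hab y) = φ (v a) y := by
  rcases le_total a b with h | h
  · induction b, h using Nat.le_induction with
    | base => rw [M.lin_refl]
    | succ b h ih =>
      have h1 := hv.between (r := b) (by omega) (by omega) hab (by omega)
      rw [← M.lin_lin h1.1 h1.2, ← ih (by omega) h1.1, ← (hφ b (by omega)).1 h1.2,
        LinearMap.comp_apply]
  · induction a, h using Nat.le_induction with
    | base => rw [M.lin_refl]
    | succ a h ih =>
      have h1 := hv.between (r := a) (by omega) (by omega) hab (by omega)
      rw [← M.lin_lin h1.1 h1.2, ih (by omega), ← (hφ a (by omega)).2 h1.1,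
        LinearMap.comp_apply]

/-- Membership in the transported subspace says precisely that `y` can be continued edge by edge:
push forward along a rising edge, choose a preimage along a falling one. -/
lemma exists_vectors_of_mem_pullZero (hv : IsZigzag v n) {j : ℕ} (hj : j < n)
    (E : Submodule k (M.obj (v j))) {y : M.obj (v 0)} (hy : y ∈ M.pullZero v j E) :
    ∃ x : ∀ a, M.obj a, x (v 0) = y ∧ x (v j) ∈ E ∧ ∀ i < j, M.CompatAt v x i := by
  classical
  induction j with
  | zero =>
    refine ⟨Function.update (fun _ => 0) (v 0) y, by simp, ?_, by simp⟩
    rw [Function.update_self]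
    exact hy
  | succ j ih =>
    obtain ⟨x, hx0, hxj, hx⟩ := ih (by omega) _ hy
    obtain ⟨z, hz, hz1, hz2⟩ : ∃ z ∈ E,
        (∀ h : v j ≤ v (j + 1), M.lin h (x (v j)) = z) ∧
        ∀ h : v (j + 1) ≤ v j, M.lin h z = x (v j) := by
      have hne : v j ≠ v (j + 1) := fun h => by
        have := hv.inj (by omega) hj h
        omega
      rw [pull] at hxj
      rcases hv.comparable hj with h | h
      · rw [dif_pos h, Submodule.mem_comap] at hxj
        exact ⟨_, hxj, fun _ => rfl, fun h' => absurd (le_antisymm h h') hne⟩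
      · have h' : ¬ v j ≤ v (j + 1) := fun h' => hne (le_antisymm h' h)
        rw [dif_neg h', dif_pos h, Submodule.mem_map] at hxj
        obtain ⟨z, hz, hzx⟩ := hxj
        exact ⟨z, hz, fun h'' => absurd h'' h', fun _ => hzx⟩
    have hne : ∀ i ≤ j, v i ≠ v (j + 1) := fun i hi h => by
      have := hv.inj (by omega) hj h
      omega
    refine ⟨Function.update x (v (j + 1)) z, ?_, by rwa [Function.update_self], ?_⟩
    · rw [Function.update_of_ne (hne 0 (by omega)), hx0]
    · intro i hi
      rcases Nat.lt_succ_iff_lt_or_eq.1 hi with hi | rfl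
      · simp only [CompatAt]
        rw [Function.update_of_ne (hne i (by omega)), Function.update_of_ne (hne (i + 1) (by omega))]
        exact hx i hi
      · simp only [CompatAt]
        rw [Function.update_of_ne (hne i (by omega)), Function.update_self]
        exact ⟨hz1, hz2⟩

/-- Dual continuation: along a rising edge a functional killing the preimage of `E` extends to one
killing `E`; along a falling edge it is composed with the structure map. -/
lemma exists_functionals_of_pullZero_le_ker (hv : IsZigzag v n) {j : ℕ} (hj : j < n)
    (E : Submodule k (M.obj (v j))) {ψ : M.obj (v 0) →ₗ[k] k}
    (hψ : M.pullZero v j E ≤ LinearMap.ker ψ) :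
    ∃ φ : ∀ a, M.obj a →ₗ[k] k, φ (v 0) = ψ ∧ E ≤ LinearMap.ker (φ (v j)) ∧
      ∀ i < j, M.CocompatAt v φ i := by
  classical
  induction j with
  | zero =>
    refine ⟨Function.update (fun _ => 0) (v 0) ψ, by simp, ?_, by simp⟩
    rw [Function.update_self]
    exact hψ
  | succ j ih =>
    obtain ⟨φ, hφ0, hφj, hφ⟩ := ih (by omega) _ hψ
    obtain ⟨χ, hχ, hχ1, hχ2⟩ : ∃ χ : M.obj (v (j + 1)) →ₗ[k] k, E ≤ LinearMap.ker χ ∧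
        (∀ h : v j ≤ v (j + 1), χ ∘ₗ M.lin h = φ (v j)) ∧
        ∀ h : v (j + 1) ≤ v j, φ (v j) ∘ₗ M.lin h = χ := by
      have hne : v j ≠ v (j + 1) := fun h => by
        have := hv.inj (by omega) hj h
        omega
      rw [pull] at hφj
      rcases hv.comparable hj with h | h
      · rw [dif_pos h] at hφj
        obtain ⟨χ, hχ, hE⟩ := LinearMap.exists_comp_eq_of_comap_le_ker _ _ _ hφj
        exact ⟨χ, hE, fun _ => hχ, fun h' => absurd (le_antisymm h h') hne⟩
      · have h' : ¬ v j ≤ v (j + 1) := fun h' => hne (le_antisymm h' h)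
        rw [dif_neg h', dif_pos h, Submodule.map_le_iff_le_comap] at hφj
        exact ⟨φ (v j) ∘ₗ M.lin h, fun z hz => hφj hz, fun h'' => absurd h'' h', fun _ => rfl⟩
    have hne : ∀ i ≤ j, v i ≠ v (j + 1) := fun i hi h => by
      have := hv.inj (by omega) hj h
      omega
    refine ⟨Function.update φ (v (j + 1)) χ, ?_, by rwa [Function.update_self], ?_⟩
    · rw [Function.update_of_ne (hne 0 (by omega)), hφ0]
    · intro i hi
      rcases Nat.lt_succ_iff_lt_or_eq.1 hi with hi | rfl
      · simp only [CocompatAt]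
        rw [Function.update_of_ne (hne i (by omega)), Function.update_of_ne (hne (i + 1) (by omega))]
        exact hφ i hi
      · simp only [CocompatAt]
        rw [Function.update_of_ne (hne i (by omega)), Function.update_self]
        exact ⟨hχ1, hχ2⟩

/-- An interval summand supported on an initial segment of a zigzag. -/
lemma hasIntervalSummand_of_mem_pullZero (hv : IsZigzag v n)
    (hsupp : ∀ y, (∀ i < n, v i ≠ y) → ∀ x : M.obj y, x = 0) {j : ℕ} (hj : j < n)
    {E E' : Submodule k (M.obj (v j))}
    (hE : j + 1 < n → ∀ h : v j ≤ v (j + 1), ∀ x ∈ E, M.lin h x = 0)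
    (hE' : j + 1 < n → ∀ h : v (j + 1) ≤ v j, ∀ x, M.lin h x ∈ E')
    {y : M.obj (v 0)} (hy : y ∈ M.pullZero v j E) (hy' : y ∉ M.pullZero v j E') :
    HasIntervalSummand M := by
  classical
  obtain ⟨x, hx0, hxj, hx⟩ := exists_vectors_of_mem_pullZero hv hj E hy
  obtain ⟨ψ, hψ, hψy⟩ := Submodule.exists_functional_eq_one _ hy'
  obtain ⟨φ, hφ0, hφj, hφ⟩ := exists_functionals_of_pullZero_le_ker hv hj E' hψ
  -- The pairing is constant along edges and equals `ψ y = 1` at the start.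
  have h1 : ∀ i ≤ j, φ (v i) (x (v i)) = 1 := by
    intro i
    induction i with
    | zero => intro _; rw [hx0, hφ0, hψy]
    | succ i ih =>
      intro hi
      rw [← ih (by omega)]
      rcases hv.comparable (i := i) (by omega) with h | h
      · rw [← (hx i (by omega)).1 h, ← (hφ i (by omega)).1 h, LinearMap.comp_apply]
      · rw [← (hx i (by omega)).2 h, ← (hφ i (by omega)).2 h, LinearMap.comp_apply]
  refine hasIntervalSummand_of_vectors (hv.isPosetInterval hj)
    (fun a => if a ∈ v '' Set.Iic j then x a else 0)
    (fun a => if a ∈ v '' Set.Iic j then φ a else 0)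
    (fun a ha => if_neg ha) ?_ (fun a ha => if_neg ha) ?_ ?_
  · intro a b hab ha
    rw [if_pos ha]
    obtain ⟨p, hp, rfl⟩ := ha
    rw [Set.mem_Iic] at hp
    by_cases hb : b ∈ v '' Set.Iic j
    · rw [if_pos hb]
      obtain ⟨q, hq, rfl⟩ := hb
      exact lin_zigzag hv hj hx hp hq hab
    rw [if_neg hb]
    by_cases hb' : ∀ i < n, v i ≠ b
    · exact hsupp b hb' _
    push Not at hb'
    obtain ⟨q, hq, rfl⟩ := hb'
    have hjq : j < q := lt_of_not_ge fun h => hb ⟨q, h, rfl⟩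
    -- A relation leaving the segment crosses the edge from `v j` to `v (j + 1)`, whose map kills
    -- `E`.
    have h2 := hv.between (r := j) (by omega) hq hab (by omega)
    have h3 := hv.between (r := j + 1) hj hq h2.2 (by omega)
    rw [← M.lin_lin h2.1 h2.2, ← M.lin_lin h3.1 h3.2, lin_zigzag hv hj hx hp le_rfl,
      hE (by omega) h3.1 _ hxj, map_zero]
  · intro a b hab hb
    rw [if_pos hb]
    obtain ⟨q, hq, rfl⟩ := hb
    rw [Set.mem_Iic] at hq
    ext z
    rw [LinearMap.comp_apply]
    by_cases ha : a ∈ v '' Set.Iic j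
    · rw [if_pos ha]
      obtain ⟨p, hp, rfl⟩ := ha
      exact comp_lin_zigzag hv hj hφ hp hq hab z
    rw [if_neg ha, LinearMap.zero_apply]
    by_cases ha' : ∀ i < n, v i ≠ a
    · rw [hsupp a ha' z, map_zero, map_zero]
    push Not at ha'
    obtain ⟨p, hp, rfl⟩ := ha'
    have hjp : j < p := lt_of_not_ge fun h => ha ⟨p, h, rfl⟩
    -- A relation entering the segment crosses the same edge, whose image lies in `E'`, on which `φ
    -- (v j)` vanishes.
    have h2 := hv.between (r := j) hp (by omega) hab (by omega)
    have h3 := hv.between (r := j + 1) hp hj h2.1 (by omega)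
    rw [← M.lin_lin h2.1 h2.2, ← M.lin_lin h3.1 h3.2, comp_lin_zigzag hv hj hφ le_rfl hq]
    exact hφj (hE' (by omega) h3.2 _)
  · rintro _ ⟨i, hi, rfl⟩
    have : v i ∈ v '' Set.Iic j := ⟨i, hi, rfl⟩
    rw [if_pos this, if_pos this]
    exact h1 i hi

/-- The interval ends at the last vertex, or at the first edge past which the transports of `⊤` and
`⊥` are no longer separated. If that edge rises, what survives at `v j` is separated between its
kernel and `⊥`; if it falls, between `⊤` and its image. -/
lemma hasIntervalSummand_of_not_pullZero_le (hv : IsZigzag v n)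
    (hsupp : ∀ y, (∀ i < n, v i ≠ y) → ∀ x : M.obj y, x = 0) {j : ℕ} (hj : j < n)
    (h : ¬ M.pullZero v j ⊤ ≤ M.pullZero v j ⊥) : HasIntervalSummand M := by
  obtain ⟨d, hd⟩ : ∃ d, d + j + 1 = n := ⟨n - 1 - j, by omega⟩
  induction d generalizing j with
  | zero =>
    obtain ⟨y, hy, hy'⟩ := SetLike.not_le_iff_exists.1 h
    exact hasIntervalSummand_of_mem_pullZero hv hsupp hj (by omega) (by omega) hy hy'
  | succ d ih =>
    by_cases hsucc : M.pullZero v (j + 1) ⊤ ≤ M.pullZero v (j + 1) ⊥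
    swap
    · exact ih (by omega) hsucc (by omega)
    have hne : v j ≠ v (j + 1) := fun h => by
      have := hv.inj hj (by omega) h
      omega
    obtain ⟨y, hy, hy'⟩ := SetLike.not_le_iff_exists.1 h
    rcases hv.comparable (i := j) (by omega) with hle | hle
    · have hle' : ¬ v (j + 1) ≤ v j := fun h' => hne (le_antisymm hle h')
      have htop : M.pull v j ⊤ = ⊤ := by rw [pull, dif_pos hle, Submodule.comap_top]
      rw [pullZero, pullZero, htop] at hsucc
      refine hasIntervalSummand_of_mem_pullZero hv hsupp hj (E := M.pull v j ⊥) (E' := ⊥)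
        (fun _ h' x hx => ?_) (fun _ h' => absurd h' hle') (hsucc hy) hy'
      rwa [pull, dif_pos hle] at hx
    · have hle' : ¬ v j ≤ v (j + 1) := fun h' => hne (le_antisymm h' hle)
      have hbot : M.pull v j ⊥ = ⊥ := by
        rw [pull, dif_neg hle', dif_pos hle, Submodule.map_bot]
      rw [pullZero, pullZero, hbot] at hsucc
      refine hasIntervalSummand_of_mem_pullZero hv hsupp hj (E := ⊤) (E' := M.pull v j ⊤)
        (fun _ h' => absurd h' hle') (fun _ h' x => ?_) hy (fun h' => hy' (hsucc h'))
      rw [pull, dif_neg hle', dif_pos hle]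
      exact ⟨x, trivial, rfl⟩

/-- Nonzero representations supported on a zigzag have interval summands. -/
theorem hasIntervalSummand_of_zigzag (hv : IsZigzag v n)
    (hsupp : ∀ y, (∀ i < n, v i ≠ y) → ∀ x : M.obj y, x = 0) (hM : ¬ IsZero M) :
    HasIntervalSummand M := by
  classical
  have hex : ∃ i, i < n ∧ ∃ x : M.obj (v i), x ≠ 0 := by
    obtain ⟨a, x, hx⟩ := exists_ne_zero hM
    by_contra hcon
    push Not at hcon
    refine hx (hsupp a (fun i hi => ?_) x)
    rintro rfl
    exact hx (hcon i hi x)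
  -- Start at the first vertex `m` where `M` is nonzero; there `⊤` is not contained in `⊥`.
  obtain ⟨hm, x, hx⟩ := Nat.find_spec hex
  have hmin := fun i => Nat.find_min (H := hex) (m := i)
  generalize Nat.find hex = m at hm x hx hmin
  refine hasIntervalSummand_of_not_pullZero_le (hv.shift m) (fun y hy z => ?_)
    (j := 0) (by omega) (fun hle => hx (hle (Submodule.mem_top (x := x))))
  by_cases h : ∃ i < n, v i = y
  · obtain ⟨i, hi, rfl⟩ := h
    by_cases him : i < m
    · by_contra hz
      exact hmin i him ⟨hi, z, hz⟩
    · refine absurd ?_ (hy (i - m) (by omega))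
      congr 1
      omega
  · push Not at h
    exact hsupp y h z

end PosetRep

end Zigzag

/-! ### Interval summands over the posets `C_{m,l}` -/

section Diamond

open PosetRep

variable {k : Type u} [Field k] {P : Type w} [PartialOrder P]

/-- `P` is the union of two chains `a 0 < ⋯ < a m` and `b 0 < ⋯ < b l` with common endpoints and
otherwise incomparable. -/
structure IsDiamond (a b : ℕ → P) (m l : ℕ) : Prop where
  pos_left : 0 < m
  pos_right : 0 < l
  bot_eq : a 0 = b 0
  top_eq : a m = b l
  left_le_iff : ∀ ⦃i j⦄, i ≤ m → j ≤ m → (a i ≤ a j ↔ i ≤ j)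
  right_le_iff : ∀ ⦃i j⦄, i ≤ l → j ≤ l → (b i ≤ b j ↔ i ≤ j)
  left_le_right_iff : ∀ ⦃i j⦄, i ≤ m → j ≤ l → (a i ≤ b j ↔ i = 0 ∨ j = l)
  right_le_left_iff : ∀ ⦃i j⦄, i ≤ m → j ≤ l → (b j ≤ a i ↔ j = 0 ∨ i = m)
  cover : ∀ y, (∃ i ≤ m, a i = y) ∨ ∃ j ≤ l, b j = y

variable {a b : ℕ → P} {m l : ℕ}

lemma IsDiamond.bot_le (h : IsDiamond a b m l) (y : P) : a 0 ≤ y := by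
  rcases h.cover y with ⟨i, hi, rfl⟩ | ⟨j, hj, rfl⟩
  · exact (h.left_le_iff (by omega) hi).2 (by omega)
  · exact (h.left_le_right_iff (by omega) hj).2 (Or.inl rfl)

lemma IsDiamond.le_top (h : IsDiamond a b m l) (y : P) : y ≤ a m := by
  rcases h.cover y with ⟨i, hi, rfl⟩ | ⟨j, hj, rfl⟩
  · exact (h.left_le_iff hi le_rfl).2 hi
  · exact (h.right_le_left_iff le_rfl hj).2 (Or.inr rfl)

/-- The zigzag obtained from a diamond by removing the least element. -/
lemma IsDiamond.isZigzag (h : IsDiamond a b m l) :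
    IsZigzag (fun i => if i < m then a (i + 1) else b (l + m - 1 - i)) (l + m - 1) where
  -- The sequence is `a 1 < ⋯ < a m = b l > ⋯ > b 1`, with the apex at index `m - 1`.
  inj i j hi hj hij := by
    have hm := h.pos_left
    have h1 := hij.le
    have h2 := hij.ge
    split_ifs at h1 h2
    · rw [h.left_le_iff (by omega) (by omega)] at h1 h2
      omega
    · rw [h.left_le_right_iff (by omega) (by omega)] at h1
      omega
    · rw [h.left_le_right_iff (by omega) (by omega)] at h2
      omega
    · rw [h.right_le_iff (by omega) (by omega)] at h1 h2
      omega
  comparable i hi := by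
    have hm := h.pos_left
    split_ifs
    · exact Or.inl ((h.left_le_iff (by omega) (by omega)).2 (by omega))
    · exact Or.inr ((h.right_le_left_iff (by omega) (by omega)).2 (by omega))
    · omega
    · exact Or.inr ((h.right_le_iff (by omega) (by omega)).2 (by omega))
  between i j r hi hj hij hr := by
    have hm := h.pos_left
    split_ifs at hij
    · rw [h.left_le_iff (by omega) (by omega)] at hij
      split_ifs
      · rw [h.left_le_iff (by omega) (by omega), h.left_le_iff (by omega) (by omega)]
        omega
      all_goals omega
    · rw [h.left_le_right_iff (by omega) (by omega)] at hij
      omega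
    · rw [h.right_le_left_iff (by omega) (by omega)] at hij
      split_ifs
      · rw [h.right_le_left_iff (by omega) (by omega), h.left_le_iff (by omega) (by omega)]
        omega
      · rw [h.right_le_iff (by omega) (by omega), h.right_le_left_iff (by omega) (by omega)]
        omega
    · rw [h.right_le_iff (by omega) (by omega)] at hij
      split_ifs
      · omega
      · rw [h.right_le_iff (by omega) (by omega), h.right_le_iff (by omega) (by omega)]
        omega
  convex i j z hi hj hiz hzj := by
    have hm := h.pos_left
    have hl := h.pos_right
    rcases h.cover z with ⟨r, hr, rfl⟩ | ⟨r, hr, rfl⟩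
    · have hr0 : r ≠ 0 := by
        rintro rfl
        split_ifs at hiz
        · rw [h.left_le_iff (by omega) (by omega)] at hiz
          omega
        · rw [h.right_le_left_iff (by omega) (by omega)] at hiz
          omega
      refine ⟨r - 1, ?_, by rw [if_pos (by omega)]; congr 1; omega⟩
      have hiz' : (i < m ∧ i + 1 ≤ r) ∨ (¬ i < m ∧ (l + m - 1 - i = 0 ∨ r = m)) := by
        split_ifs at hiz
        · exact Or.inl ⟨‹_›, (h.left_le_iff (by omega) (by omega)).1 hiz⟩
        · exact Or.inr ⟨‹_›, (h.right_le_left_iff (by omega) (by omega)).1 hiz⟩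
      have hzj' : (j < m ∧ r ≤ j + 1) ∨ (¬ j < m ∧ (r = 0 ∨ l + m - 1 - j = l)) := by
        split_ifs at hzj
        · exact Or.inl ⟨‹_›, (h.left_le_iff (by omega) (by omega)).1 hzj⟩
        · exact Or.inr ⟨‹_›, (h.left_le_right_iff (by omega) (by omega)).1 hzj⟩
      omega
    · have hr0 : r ≠ 0 := by
        rintro rfl
        split_ifs at hiz
        · rw [h.left_le_right_iff (by omega) (by omega)] at hiz
          omega
        · rw [h.right_le_iff (by omega) (by omega)] at hiz
          omega
      refine ⟨l + m - 1 - r, ?_, ?_⟩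
      · have hiz' : (i < m ∧ (i + 1 = 0 ∨ r = l)) ∨ (¬ i < m ∧ l + m - 1 - i ≤ r) := by
          split_ifs at hiz
          · exact Or.inl ⟨‹_›, (h.left_le_right_iff (by omega) (by omega)).1 hiz⟩
          · exact Or.inr ⟨‹_›, (h.right_le_iff (by omega) (by omega)).1 hiz⟩
        have hzj' : (j < m ∧ (r = 0 ∨ j + 1 = m)) ∨ (¬ j < m ∧ r ≤ l + m - 1 - j) := by
          split_ifs at hzj
          · exact Or.inl ⟨‹_›, (h.right_le_left_iff (by omega) (by omega)).1 hzj⟩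
          · exact Or.inr ⟨‹_›, (h.right_le_iff (by omega) (by omega)).1 hzj⟩
        omega
      -- The apex `b l` is listed as `a m`, in the first branch of the enumeration.
      · by_cases hrl : r = l
        · subst hrl
          rw [if_pos (by omega), ← h.top_eq]
          congr 1
          omega
        · rw [if_neg (by omega)]
          congr 1
          omega

/-- A convex set with a least element is an interval. -/
lemma isPosetInterval_of_isLeast [Finite P] {I : Set P} {s : P} (hs : IsLeast I s)
    (hconv : ∀ ⦃x y z : P⦄, x ∈ I → y ∈ I → x < z → z < y → z ∈ I) : IsPosetInterval I where
  convex := hconv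
  connected := by
    have : Nonempty I := ⟨⟨s, hs.1⟩⟩
    refine ⟨fun x y => ?_⟩
    have key : ∀ x : I, (SimpleGraph.hasse I).Reachable ⟨s, hs.1⟩ x := fun x =>
      SimpleGraph.hasse_reachable_of_le (show (⟨s, hs.1⟩ : I) ≤ x from hs.2 x.2)
    exact (key x).symm.trans (key y)

namespace PosetRep

variable {M : PosetRep k P}

/-- If the map from the least to the greatest element is nonzero, then `k_P` is a summand. -/
lemma hasIntervalSummand_of_lin_ne_zero [Finite P] {s t : P} (hs : ∀ y, s ≤ y) (ht : ∀ y, y ≤ t)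
    {u : M.obj s} (hu : M.lin (hs t) u ≠ 0) : HasIntervalSummand M := by
  obtain ⟨ψ, -, hψ⟩ := Submodule.exists_functional_eq_one (k := k) ⊥
    (show M.lin (hs t) u ∉ (⊥ : Submodule k (M.obj t)) by simpa using hu)
  refine hasIntervalSummand_of_vectors (I := Set.univ)
    (isPosetInterval_of_isLeast (s := s) ⟨trivial, fun y _ => hs y⟩ (fun _ _ _ _ _ _ _ => trivial))
    (fun y => M.lin (hs y) u) (fun y => ψ ∘ₗ M.lin (ht y)) (by simp) (by simp) (by simp) ?_ ?_
  · intro y z hyz _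
    ext x
    simp
  · intro y _
    simpa using hψ

lemma hasIntervalSummand_of_diamond [Finite P] (h : IsDiamond a b m l) (hM : ¬ IsZero M) :
    HasIntervalSummand M := by
  classical
  by_cases hs : ∀ x : M.obj (a 0), x = 0
  · refine hasIntervalSummand_of_zigzag h.isZigzag (fun y hy x => ?_) hM
    have hy0 : y = a 0 := by
      have hm := h.pos_left
      by_contra hne
      rcases h.cover y with ⟨i, hi, rfl⟩ | ⟨j, hj, rfl⟩
      · have hi0 : i ≠ 0 := by rintro rfl; exact hne rfl
        have hl := h.pos_right
        have := hy (i - 1) (by omega)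
        rw [if_pos (by omega), Nat.sub_add_cancel (by omega)] at this
        exact this rfl
      · have hj0 : j ≠ 0 := by rintro rfl; exact hne h.bot_eq.symm
        have := hy (l + m - 1 - j) (by omega)
        by_cases hjl : j = l
        · subst hjl
          rw [if_pos (by omega), show j + m - 1 - j + 1 = m by omega] at this
          exact this h.top_eq
        · rw [if_neg (by omega), show l + m - 1 - (l + m - 1 - j) = j by omega] at this
          exact this rfl
    subst hy0
    exact hs x
  by_cases hα : ∃ u, M.lin (h.bot_le (a m)) u ≠ 0
  · obtain ⟨u, hu⟩ := hα
    exact hasIntervalSummand_of_lin_ne_zero h.bot_le h.le_top hu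
  push Not at hs hα
  obtain ⟨u₀, hu₀⟩ := hs
  let K : P → Submodule k (M.obj (a 0)) := fun y => LinearMap.ker (M.lin (h.bot_le y))
  have hK0 : K (a 0) = ⊥ := by
    refine LinearMap.ker_eq_bot'.2 fun x hx => ?_
    rwa [M.lin_refl] at hx
  have hexp : ∃ i, i ≤ m ∧ K (a i) ≠ ⊥ := by
    refine ⟨m, le_rfl, fun hbot => hu₀ ?_⟩
    rw [← Submodule.mem_bot k, ← hbot]
    exact hα u₀
  -- Minimality of `p` makes the map from the minimum to `a (p - 1)` injective. Then `q` is minimal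
  -- relative to this `p`, so a nonzero `u` dies at both `a p` and `b q` but survives at `a (p - 1)`
  -- and `b (q - 1)`.
  obtain ⟨hpm, hp⟩ := Nat.find_spec hexp
  have hpmin := fun i => Nat.find_min (H := hexp) (m := i)
  generalize Nat.find hexp = p at hpm hp hpmin
  have hp0 : p ≠ 0 := by
    rintro rfl
    exact hp hK0
  have hexq : ∃ j, j ≤ l ∧ K (a p) ⊓ K (b j) ≠ ⊥ := by
    refine ⟨l, le_rfl, ?_⟩
    have : K (b l) = ⊤ := by
      rw [eq_top_iff]
      intro x _
      rw [← h.top_eq]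
      exact hα x
    rwa [this, inf_top_eq]
  obtain ⟨hql, hq⟩ := Nat.find_spec hexq
  have hqmin := fun j => Nat.find_min (H := hexq) (m := j)
  generalize Nat.find hexq = q at hql hq hqmin
  have hq0 : q ≠ 0 := by
    rintro rfl
    rw [← h.bot_eq, hK0, inf_bot_eq] at hq
    exact hq rfl
  obtain ⟨u, ⟨hup, huq⟩, hu0⟩ := Submodule.exists_mem_ne_zero_of_ne_bot hq
  have hKp : K (a (p - 1)) = ⊥ := by
    by_contra hne
    exact hpmin (p - 1) (by omega) ⟨by omega, hne⟩
  have hKq : u ∉ K (b (q - 1)) := by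
    intro hu
    have : K (a p) ⊓ K (b (q - 1)) = ⊥ := by
      by_contra hne
      exact hqmin (q - 1) (by omega) ⟨by omega, hne⟩
    apply hu0
    rw [← Submodule.mem_bot k, ← this]
    exact ⟨hup, hu⟩
  -- A functional at the minimum which extends along both branches: along `a` by injectivity, along
  -- `b` because it kills `K (b (q - 1))`.
  obtain ⟨φ₀, hφ₀, hφ₀u⟩ := Submodule.exists_functional_eq_one _ hKq
  obtain ⟨χ, hχ, -⟩ := LinearMap.exists_comp_eq_of_comap_le_ker (M.lin (h.bot_le (a (p - 1)))) ⊥ φ₀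
    (by
      change K (a (p - 1)) ≤ _
      rw [hKp]
      exact bot_le)
  obtain ⟨χ', hχ', -⟩ := LinearMap.exists_comp_eq_of_comap_le_ker
    (M.lin (h.bot_le (b (q - 1)))) ⊥ φ₀ hφ₀
  let I : Set P := {y | y ≤ a (p - 1) ∨ y ≤ b (q - 1)}
  have hI : IsPosetInterval I := by
    refine isPosetInterval_of_isLeast (s := a 0) ⟨Or.inl (h.bot_le _), fun y _ => h.bot_le y⟩ ?_
    rintro x y z _ (hy | hy) _ hzy
    · exact Or.inl (hzy.le.trans hy)
    · exact Or.inr (hzy.le.trans hy)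
  have hmeet : ∀ y, y ≤ a (p - 1) → y ≤ b (q - 1) → y = a 0 := by
    intro y hya hyb
    rcases h.cover y with ⟨i, hi, rfl⟩ | ⟨j, hj, rfl⟩
    · rw [h.left_le_right_iff hi (by omega)] at hyb
      have : i = 0 := by omega
      rw [this]
    · rw [h.right_le_left_iff (by omega) hj] at hya
      have : j = 0 := by omega
      rw [this, h.bot_eq]
  refine hasIntervalSummand_of_vectors hI (fun y => M.lin (h.bot_le y) u)
    (fun y => if hy : y ≤ a (p - 1) then χ ∘ₗ M.lin hy
      else if hy : y ≤ b (q - 1) then χ' ∘ₗ M.lin hy else 0) ?_ (by simp) ?_ ?_ ?_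
  · intro y hy
    have hge : a p ≤ y ∨ b q ≤ y := by
      rw [Set.mem_ofPred_eq, not_or] at hy
      rcases h.cover y with ⟨i, hi, rfl⟩ | ⟨j, hj, rfl⟩
      · rw [h.left_le_iff hi (by omega)] at hy
        exact Or.inl ((h.left_le_iff hpm hi).2 (by omega))
      · rw [h.right_le_iff hj (by omega)] at hy
        exact Or.inr ((h.right_le_iff hql hj).2 (by omega))
    rcases hge with hge | hge
    · have : M.lin (h.bot_le (a p)) u = 0 := hup
      rw [← M.lin_lin (h.bot_le _) hge, this, map_zero]
    · have : M.lin (h.bot_le (b q)) u = 0 := huq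
      rw [← M.lin_lin (h.bot_le _) hge, this, map_zero]
  · intro y hy
    rw [Set.mem_ofPred_eq, not_or] at hy
    rw [dif_neg hy.1, dif_neg hy.2]
  · intro y z hyz hz
    by_cases hza : z ≤ a (p - 1)
    · rw [dif_pos hza, dif_pos (hyz.trans hza)]
      ext x
      simp
    · have hzb : z ≤ b (q - 1) := hz.resolve_left hza
      rw [dif_neg hza, dif_pos hzb]
      by_cases hya : y ≤ a (p - 1)
      -- The two branches of `I` meet only at the minimum, where `χ` and `χ'` both restrict to `φ₀`.
      · obtain rfl := hmeet y hya (hyz.trans hzb)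
        rw [dif_pos hya]
        refine Eq.trans ?_ hχ.symm
        refine Eq.trans ?_ hχ'
        ext x
        simp
      · rw [dif_neg hya, dif_pos (hyz.trans hzb)]
        ext x
        simp
  · intro y hy
    by_cases hya : y ≤ a (p - 1)
    · rw [dif_pos hya, LinearMap.comp_apply, M.lin_lin, ← hφ₀u, ← hχ, LinearMap.comp_apply]
    · rw [dif_neg hya, dif_pos (hy.resolve_left hya), LinearMap.comp_apply, M.lin_lin, ← hφ₀u,
        ← hχ', LinearMap.comp_apply]

end PosetRep

end Diamond

/-! ### Representations that are not interval-decomposable -/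

section Obstructions

open PosetRep

variable {k : Type u} [Field k] {P : Type w} [PartialOrder P]

/-- An obstruction to interval decomposability: a functional that detects the identity but none
of the noninjective endomorphisms at a point where the dimension is at least two. -/
lemma not_intervalDecomposable_of_endomorphisms {M : PosetRep k P} {x : P}
    (hx : 1 < Module.finrank k (M.obj x)) (y : M.obj x) (ψ : M.obj x →ₗ[k] k) (hy : ψ y ≠ 0)
    (h : ∀ E : M ⟶ M, ¬ Function.Injective (appLin E x) → ψ (appLin E x y) = 0) :
    ¬ IntervalDecomposable k P M := by
  intro hM
  obtain ⟨r, I, i, p, hip⟩ := hM.exists_endomorphisms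
  apply hy
  -- The identity is a sum of endomorphisms factoring through interval modules, which have dimension
  -- at most one at `x`; none is injective there, so `ψ` kills every term.
  rw [← appLin_id M x y, ← hip, appLin_sum, LinearMap.sum_apply, map_sum]
  refine Finset.sum_eq_zero fun s _ => h _ fun hinj => hx.not_ge ?_
  have hp : Function.Injective (appLin (p s) x) := fun a b hab => hinj (by
    rw [appLin_comp, appLin_comp, hab])
  let g : M.obj x →ₗ[k] intervalSpace k (I s).1 x := appLin (p s) x
  have h1 := LinearMap.finrank_le_finrank_of_injective (f := g) hp
  have h2 := Submodule.finrank_le (intervalSpace k (I s).1 x)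
  rw [Module.finrank_self] at h2
  exact h1.trans h2

namespace PosetRep

variable {V : Type u} [AddCommGroup V] [Module k V]

lemma inclusion_subquotient_le {A A' B B' : Submodule k V} (hA : A ≤ A') (hB : B ≤ B') :
    B.submoduleOf A ≤ (B'.submoduleOf A').comap (Submodule.inclusion hA) :=
  fun _ hz => hB hz

variable [Module.Finite k V]

/-- The representation with spaces `A a / (A a ∩ B a)` for monotone families of subspaces. -/
noncomputable def subquotient (A B : P → Submodule k V) (hA : Monotone A) (hB : Monotone B) :
    PosetRep k P :=
  PosetRep.mk (fun a => A a ⧸ (B a).submoduleOf (A a))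
    (fun h => Submodule.mapQ _ _ (Submodule.inclusion (hA h))
      (inclusion_subquotient_le (hA h) (hB h)))
    (fun a x => by
      induction x using Submodule.Quotient.induction_on with
      | _ x => rfl)
    (fun h h' x => by
      induction x using Submodule.Quotient.induction_on with
      | _ x => rfl)

variable {A B : P → Submodule k V} (hA : Monotone A) (hB : Monotone B)

/-- The class of an element of `A a` in the subquotient. -/
noncomputable def subquotientMk (a : P) : A a →ₗ[k] (subquotient A B hA hB).obj a :=
  Submodule.mkQ ((B a).submoduleOf (A a))

lemma subquotientMk_surjective (a : P) : Function.Surjective (subquotientMk hA hB a) :=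
  Submodule.mkQ_surjective _

lemma subquotientMk_eq_zero_iff (a : P) (x : A a) :
    subquotientMk hA hB a x = 0 ↔ (x : V) ∈ B a :=
  Submodule.Quotient.mk_eq_zero _

lemma lin_subquotientMk {a b : P} (h : a ≤ b) (x : A a) :
    (subquotient A B hA hB).lin h (subquotientMk hA hB a x) =
      subquotientMk hA hB b ⟨x, hA h x.2⟩ := rfl

end PosetRep

/-- An endomorphism of `k²` preserving three given distinct lines is a homothety. -/
lemma exists_smul_of_three_lines (e : k × k →ₗ[k] k × k)
    (h1 : e (1, 0) ∈ Submodule.span k {((1, 0) : k × k)})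
    (h2 : e (0, 1) ∈ Submodule.span k {((0, 1) : k × k)})
    (h3 : e (1, 1) ∈ Submodule.span k {((1, 1) : k × k)}) : ∃ c : k, ∀ x, e x = c • x := by
  obtain ⟨a, ha⟩ := Submodule.mem_span_singleton.1 h1
  obtain ⟨b, hb⟩ := Submodule.mem_span_singleton.1 h2
  obtain ⟨c, hc⟩ := Submodule.mem_span_singleton.1 h3
  have h : e (1, 1) = e (1, 0) + e (0, 1) := by rw [← map_add]; simp
  rw [← ha, ← hb, ← hc] at h
  simp at h
  refine ⟨c, fun x => ?_⟩
  have hx : x = x.1 • (1, 0) + x.2 • (0, 1) := by ext <;> simp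
  conv_lhs => rw [hx, map_add, map_smul, map_smul, ← ha, ← hb, ← h.1, ← h.2]
  ext <;> simp [mul_comm]

/-- Three distinct lines in `k²`. -/
def threeLines (k : Type u) [Field k] (i : Fin 3) : Submodule k (k × k) :=
  Submodule.span k {(![(1, 0), (0, 1), (1, 1)] : Fin 3 → k × k) i}

/-- A point with three neighbours in the Hasse diagram yields a representation which is not
interval-decomposable. -/
theorem exists_not_intervalDecomposable_of_three_neighbors (k : Type u) [Field k] {x : P}
    {c : Fin 3 → P} (hc : Function.Injective c) (hadj : ∀ i, c i ⋖ x ∨ x ⋖ c i) :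
    ∃ M : PosetRep k P, ¬ IntervalDecomposable k P M := by
  -- The subquotient is `k²` at `x`, the `i`-th line at a lower neighbour `c i` and the quotient by
  -- the `i`-th line at an upper one. Hence endomorphisms preserve all three lines, whatever the
  -- orientation.
  let A : P → Submodule k (k × k) := fun y =>
    (⨆ (_ : x ≤ y), ⊤) ⊔ ⨆ (i) (_ : c i < x ∧ c i ≤ y), threeLines k i
  let B : P → Submodule k (k × k) := fun y => ⨆ (i) (_ : x < c i ∧ c i ≤ y), threeLines k i
  have hA : Monotone A := fun y z hyz => sup_le_sup
    (iSup_mono' fun h => ⟨h.trans hyz, le_rfl⟩)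
    (iSup_mono fun i => iSup_mono' fun h => ⟨⟨h.1, h.2.trans hyz⟩, le_rfl⟩)
  have hB : Monotone B := fun y z hyz =>
    iSup_mono fun i => iSup_mono' fun h => ⟨⟨h.1, h.2.trans hyz⟩, le_rfl⟩
  have hAtop : ∀ y, x ≤ y → ∀ z, z ∈ A y := fun y hy z => by
    have : A y = ⊤ := by simp [A, hy]
    rw [this]; trivial
  have hBx : B x = ⊥ := by
    simp only [B, iSup_eq_bot]
    exact fun i h => absurd h.1 h.2.not_gt
  have hlow : ∀ i, c i < x → A (c i) = threeLines k i := by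
    intro i hi
    refine le_antisymm (sup_le ?_ ?_) ?_
    · exact iSup_le fun h => absurd hi h.not_gt
    · refine iSup₂_le fun j hj => ?_
      -- Neighbours on the same side of `x` are pairwise incomparable, so only one line contributes.
      have : c j = c i := by
        by_contra hne
        exact ((hadj j).resolve_right fun h => hj.1.not_gt h.lt).2 (lt_of_le_of_ne hj.2 hne) hi
      rw [hc this]
    · exact le_sup_of_le_right (le_iSup₂_of_le i ⟨hi, le_rfl⟩ le_rfl)
  have hupp : ∀ i, x < c i → B (c i) = threeLines k i := by
    intro i hi
    refine le_antisymm ?_ (le_iSup₂_of_le i ⟨hi, le_rfl⟩ le_rfl)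
    refine iSup₂_le fun j hj => ?_
    have : c j = c i := by
      by_contra hne
      exact ((hadj i).resolve_left fun h => hi.not_gt h.lt).2 hj.1 (lt_of_le_of_ne hj.2 hne)
    rw [hc this]
  let M := subquotient A B hA hB
  let q₀ : k × k →ₗ[k] M.obj x :=
    subquotientMk hA hB x ∘ₗ LinearMap.codRestrict (A x) LinearMap.id (hAtop x le_rfl)
  have hq₀ : Function.Bijective q₀ := by
    constructor
    · rw [← LinearMap.ker_eq_bot, LinearMap.ker_eq_bot']
      intro z hz
      have := (subquotientMk_eq_zero_iff hA hB x _).1 hz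
      rw [hBx] at this
      exact this
    · intro y
      obtain ⟨z, rfl⟩ := subquotientMk_surjective hA hB x y
      exact ⟨z, rfl⟩
  let q : (k × k) ≃ₗ[k] M.obj x := LinearEquiv.ofBijective q₀ hq₀
  have hq : ∀ (z : k × k) (hz : z ∈ A x), q z = subquotientMk hA hB x ⟨z, hz⟩ := fun _ _ => rfl
  have key : ∀ (E : M ⟶ M) (i : Fin 3), ∀ z ∈ threeLines k i,
      q.symm (appLin E x (q z)) ∈ threeLines k i := by
    intro E i z hz
    rcases hadj i with h | h
    · have hz' : z ∈ A (c i) := by rwa [hlow i h.lt]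
      obtain ⟨y, hy⟩ := subquotientMk_surjective hA hB (c i)
        (appLin E (c i) (subquotientMk hA hB (c i) ⟨z, hz'⟩))
      have h1 : appLin E x (q z) = q y := by
        rw [hq z (hAtop x le_rfl z), hq y (hAtop x le_rfl y),
          ← lin_subquotientMk hA hB h.le ⟨z, hz'⟩, ← lin_subquotientMk hA hB h.le y,
          appLin_naturality, hy]
      rw [h1, q.symm_apply_apply, ← hlow i h.lt]
      exact y.2
    · obtain ⟨y, hy⟩ := q.surjective (appLin E x (q z))
      rw [← hy, q.symm_apply_apply, ← hupp i h.lt]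
      have h1 : M.lin h.le (q z) = 0 := by
        rw [hq z (hAtop x le_rfl z), lin_subquotientMk, subquotientMk_eq_zero_iff]
        rwa [hupp i h.lt]
      have h2 : M.lin h.le (q y) = 0 := by
        rw [hy, ← appLin_naturality, h1, map_zero]
      rwa [hq y (hAtop x le_rfl y), lin_subquotientMk, subquotientMk_eq_zero_iff] at h2
  refine ⟨M, not_intervalDecomposable_of_endomorphisms (x := x) ?_ (q (1, 0))
    (LinearMap.fst k k k ∘ₗ q.symm.toLinearMap) (by simp) fun E hE => ?_⟩
  · rw [← q.finrank_eq]
    simp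
  · obtain ⟨a, ha⟩ := exists_smul_of_three_lines
      (q.symm.toLinearMap ∘ₗ appLin E x ∘ₗ q.toLinearMap)
      (key E 0 _ (Submodule.mem_span_singleton_self _))
      (key E 1 _ (Submodule.mem_span_singleton_self _))
      (key E 2 _ (Submodule.mem_span_singleton_self _))
    have ha' : ∀ y, appLin E x y = a • y := fun y => by
      have := ha (q.symm y)
      simp only [LinearMap.comp_apply, LinearEquiv.coe_coe, q.apply_symm_apply] at this
      rw [← map_smul] at this
      exact q.symm.injective this
    have ha0 : a = 0 := by
      by_contra ha0
      refine hE fun y z hyz => ?_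
      rw [ha', ha'] at hyz
      exact smul_right_injective _ ha0 hyz
    rw [ha', ha0, zero_smul, map_zero]

/-- The unipotent Jordan block of size two. -/
def jordanBlock (k : Type u) [Field k] : k × k →ₗ[k] k × k :=
  (LinearMap.fst k k k + LinearMap.snd k k k).prod (LinearMap.snd k k k)

/-- The commutant consists of the matrices `α + βN` with `N` nilpotent, and such a matrix is
injective as soon as `α ≠ 0`; here `α` is `(e (1, 0)).1`. This holds in every characteristic. -/
lemma fst_eq_zero_of_comm_jordanBlock (e : k × k →ₗ[k] k × k)
    (h : ∀ x, e (jordanBlock k x) = jordanBlock k (e x)) (he : ¬ Function.Injective e) :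
    (e (1, 0)).1 = 0 := by
  by_contra ha
  apply he
  have h1 := h (1, 0)
  have h2 := h (0, 1)
  have h3 : e (1, 1) = e (1, 0) + e (0, 1) := by rw [← map_add]; simp
  simp [jordanBlock, h3, Prod.ext_iff] at h1 h2
  rw [← LinearMap.ker_eq_bot, LinearMap.ker_eq_bot']
  intro x hx
  have hx' : x = x.1 • (1, 0) + x.2 • (0, 1) := by ext <;> simp
  rw [hx', map_add, map_smul, map_smul, Prod.ext_iff] at hx
  simp [h1] at hx
  rw [show (e (0, 1)).2 = (e (1, 0)).1 by linear_combination -h2.1] at hx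
  have h4 : x.2 = 0 := hx.2.resolve_right ha
  rw [h4, zero_mul, add_zero] at hx
  exact Prod.ext (by simpa [ha] using hx.1) h4

open Classical in
/-- The representation with monodromy given by a Jordan block along the edge from `d` to the
maximal element `t`. -/
noncomputable def monodromyRep (k : Type u) [Field k] {t d d' : P} (ht : ∀ y, t ≤ y → y = t)
    (hd : d < t) (hcov : ∀ y, y < t → y ≤ d ∨ y ≤ d') (hlb : ∀ y, y ≤ d → ¬ y ≤ d') :
    PosetRep k P :=
  PosetRep.mk (fun _ => k × k)
    (fun {a b} _ => if b = t ∧ a ≤ d then jordanBlock k else LinearMap.id)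
    (fun a x => by
      rw [if_neg]
      · rfl
      · rintro ⟨rfl, h⟩
        exact hd.not_ge h)
    (fun {a b c} h h' x => by
      by_cases hc : c = t
      · subst hc
        by_cases hb : b = c
        · subst hb
          rw [if_neg (fun h => hd.not_ge h.2)]
          rfl
        have hbc : b < c := lt_of_le_of_ne h' hb
        rw [if_neg (c := b = c ∧ a ≤ d) (fun h => hb h.1), LinearMap.id_apply]
        -- Functoriality below `t`: an element `a ≤ b < t` lies under `d` exactly when `b` does,
        -- since nothing lies under both `d` and `d'`.
        congr 2
        simp only [true_and, eq_iff_iff]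
        refine ⟨h.trans, fun had => (hcov b hbc).resolve_right fun hbd => ?_⟩
        exact hlb a had (h.trans hbd)
      · have hb : b ≠ t := by
          rintro rfl
          exact hc (ht c h')
        rw [if_neg (fun h => hc h.1), if_neg (fun h => hb h.1), if_neg (fun h => hc h.1)]
        rfl)

/-- A nontrivial loop in the Hasse diagram yields a representation which is not
interval-decomposable. -/
theorem exists_not_intervalDecomposable_of_monodromy (k : Type u) [Field k] {t d d' : P}
    (ht : ∀ y, t ≤ y → y = t) (hd : d < t) (hcov : ∀ y, y < t → y ≤ d ∨ y ≤ d')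
    (hlb : ∀ y, y ≤ d → ¬ y ≤ d')
    (hreach : ((SimpleGraph.hasse P).deleteEdges {s(t, d)}).Reachable t d) :
    ∃ M : PosetRep k P, ¬ IntervalDecomposable k P M := by
  classical
  let M := monodromyRep k ht hd hcov hlb
  refine ⟨M, not_intervalDecomposable_of_endomorphisms (x := d) ?_ (show k × k from (1, 0))
    (LinearMap.fst k k k) one_ne_zero fun E hE => ?_⟩
  · change 1 < Module.finrank k (k × k)
    simp
  let e : P → k × k →ₗ[k] k × k := fun y => appLin E y
  have hnat : ∀ {a b : P} (h : a ≤ b) (x : k × k),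
      e b ((if b = t ∧ a ≤ d then jordanBlock k else LinearMap.id) x) =
        (if b = t ∧ a ≤ d then jordanBlock k else LinearMap.id) (e a x) :=
    fun h x => appLin_naturality E h x
  -- The only cover relation carrying the Jordan block is `d ⋖ t`.
  have hid : ∀ {a b : P}, a ⋖ b → s(a, b) ≠ s(t, d) → e a = e b := by
    intro a b hab hne
    have h0 : ¬ (b = t ∧ a ≤ d) := by
      rintro ⟨rfl, had⟩
      rcases had.eq_or_lt with rfl | had
      · exact hne Sym2.eq_swap
      · exact hab.2 had hd
    refine LinearMap.ext fun x => ?_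
    have := hnat hab.le x
    rw [if_neg h0] at this
    exact this.symm
  have hwalk : ∀ {a b : P}, ((SimpleGraph.hasse P).deleteEdges {s(t, d)}).Reachable a b →
      e a = e b := by
    rintro a b ⟨p⟩
    induction p with
    | nil => rfl
    | cons h p ih =>
      rw [← ih]
      rw [SimpleGraph.deleteEdges_adj] at h
      rcases h.1 with h1 | h1
      · exact hid h1 h.2
      · exact (hid h1 (fun h2 => h.2 (Sym2.eq_swap.trans h2))).symm
  -- Going round the loop identifies the components at `t` and `d`; naturality along `d < t` then
  -- makes this component commute with the block.
  refine fst_eq_zero_of_comm_jordanBlock (e d) (fun x => ?_) hE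
  have := hnat hd.le x
  rw [if_pos ⟨rfl, le_rfl⟩, hwalk hreach] at this
  exact this

end Obstructions

/-! ### Recognition of paths among graphs -/

namespace SimpleGraph

variable {V : Type*} {G : SimpleGraph V}

/-- The required vertex is the one just before `x` on a geodesic from `v`. -/
lemma Connected.exists_adj_dist_eq (hG : G.Connected) {v x : V} {d : ℕ} (h : G.dist v x = d + 1) :
    ∃ y, G.Adj y x ∧ G.dist v y = d := by
  obtain ⟨p, hp⟩ := hG.exists_walk_length_eq_dist x v
  rw [dist_comm, h] at hp
  cases p with
  | nil => simp at hp
  | cons hadj q =>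
    rename_i y
    refine ⟨y, hadj.symm, ?_⟩
    have h1 : G.dist y v ≤ q.length := dist_le q
    rw [Walk.length_cons] at hp
    rw [dist_comm] at h1
    have h2 := hadj.symm.diff_dist_adj (u := v)
    omega

lemma eq_or_eq_of_ncard_le_two [Finite V] {x a b c : V} (h : (G.neighborSet x).ncard ≤ 2)
    (ha : G.Adj x a) (hb : G.Adj x b) (hab : a ≠ b) (hc : G.Adj x c) : c = a ∨ c = b := by
  by_contra hcon
  push Not at hcon
  exact h.not_gt ((Set.two_lt_ncard_iff).2 ⟨a, b, c, ha, hb, hc, hab, hcon.1.symm, hcon.2.symm⟩)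

/-- In a connected graph of maximal degree at most two, the distance from a vertex of degree at
most one is injective. -/
lemma Connected.dist_injective [Finite V] (hG : G.Connected)
    (hdeg : ∀ x, (G.neighborSet x).ncard ≤ 2) {v : V} (hv : (G.neighborSet v).ncard ≤ 1) :
    Function.Injective (G.dist v) := by
  intro x y hxy
  obtain ⟨d, hd⟩ : ∃ d, G.dist v x = d := ⟨_, rfl⟩
  rw [hd] at hxy
  induction d using Nat.strong_induction_on generalizing x y with
  | _ d ih =>
    rcases d with _ | d
    · rw [← hG.dist_eq_zero_iff.1 hd, ← hG.dist_eq_zero_iff.1 hxy.symm]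
    obtain ⟨x', hx, hx'⟩ := hG.exists_adj_dist_eq hd
    obtain ⟨y', hy, hy'⟩ := hG.exists_adj_dist_eq hxy.symm
    obtain rfl := ih d (by omega) hy'.symm hx'
    rcases d with _ | d
    · obtain rfl := hG.dist_eq_zero_iff.1 hx'
      exact (Set.ncard_le_one_iff).1 hv hx hy
    -- The common predecessor `x'` already has a neighbour `z` closer to `v`, so it has room for
    -- only one farther away.
    · obtain ⟨z, hz, hz'⟩ := hG.exists_adj_dist_eq hx'
      have hzx : z ≠ x := by
        rintro rfl
        omega
      rcases eq_or_eq_of_ncard_le_two (hdeg x') hz.symm hx hzx hy with h | h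
      · rw [h] at hxy
        omega
      · exact h.symm

/-- A connected graph of maximal degree at most two with a vertex of degree at most one is a
path. -/
theorem Connected.nonempty_iso_pathGraph [Finite V] (hG : G.Connected)
    (hdeg : ∀ x, (G.neighborSet x).ncard ≤ 2) {v : V} (hv : (G.neighborSet v).ncard ≤ 1) {n : ℕ}
    (hn : Nat.card V = n) : Nonempty (G ≃g pathGraph n) := by
  cases nonempty_fintype V
  have hinj := hG.dist_injective hdeg hv
  have hlt : ∀ x, G.dist v x < n := by
    intro x
    obtain ⟨p, hp, hpl⟩ := hG.exists_path_of_dist v x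
    rw [← hpl, ← hn, Nat.card_eq_fintype_card]
    exact hp.length_lt
  let f : V → Fin n := fun x => ⟨G.dist v x, hlt x⟩
  have hf : Function.Bijective f := by
    rw [Fintype.bijective_iff_injective_and_card]
    refine ⟨fun x y hxy => hinj (congrArg Fin.val hxy), ?_⟩
    rw [Fintype.card_fin, ← hn, Nat.card_eq_fintype_card]
  have hback : ∀ x y, G.dist v x + 1 = G.dist v y → G.Adj x y := by
    intro x y h
    obtain ⟨z, hz, hz'⟩ := hG.exists_adj_dist_eq h.symm
    rwa [← hinj hz']
  refine ⟨⟨Equiv.ofBijective f hf, fun {x y} => ?_⟩⟩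
  rw [pathGraph_adj]
  change G.dist v x + 1 = G.dist v y ∨ G.dist v y + 1 = G.dist v x ↔ _
  constructor
  · rintro (h | h)
    · exact hback _ _ h
    · exact (hback _ _ h).symm
  · intro h
    have h1 := h.diff_dist_adj (u := v)
    have h2 := h.symm.diff_dist_adj (u := v)
    have h3 : G.dist v x ≠ G.dist v y := fun h' => h.ne (hinj h')
    omega

end SimpleGraph

/-! ### Posets of type A as zigzags -/

section TypeA

variable {P : Type w} [PartialOrder P] [Finite P]

/-- A relation is a chain of covers, each moving the index by one, so the chain visits every index
between its ends. -/
lemma IsTypeA.between {n : ℕ} (e : SimpleGraph.hasse P ≃g SimpleGraph.pathGraph n) {x y : P}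
    (hxy : x ≤ y) {z : P} (hz : e x ≤ e z ∧ e z ≤ e y ∨ e y ≤ e z ∧ e z ≤ e x) :
    x ≤ z ∧ z ≤ y := by
  classical
  cases nonempty_fintype P
  let _ : LocallyFiniteOrder P := Fintype.toLocallyFiniteOrder
  rw [le_iff_reflTransGen_covBy] at hxy
  induction hxy with
  | refl =>
    have : z = x := e.injective (by omega)
    subst this
    exact ⟨le_rfl, le_rfl⟩
  | tail hxb hbc ih =>
    rename_i b c
    rw [← le_iff_reflTransGen_covBy] at hxb
    have hadj := SimpleGraph.pathGraph_adj.1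
      (e.map_adj_iff.2 (show (SimpleGraph.hasse P).Adj b c from Or.inl hbc))
    by_cases hzc : z = c
    · subst hzc
      exact ⟨hxb.trans hbc.le, le_rfl⟩
    · have hne : e z ≠ e c := fun h => hzc (e.injective h)
      have hne' : (e z).val ≠ (e c).val := fun h => hne (Fin.ext h)
      simp only [Fin.le_def] at hz ih
      obtain ⟨h1, h2⟩ := ih (by omega)
      exact ⟨h1, h2.trans hbc.le⟩

/-- A poset of type `A` is a zigzag. -/
lemma IsTypeA.exists_isZigzag [Nonempty P] {n : ℕ} (h : IsTypeA P n) :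
    ∃ v : ℕ → P, IsZigzag v n ∧ ∀ y, ∃ i < n, v i = y := by
  classical
  obtain ⟨e⟩ := h
  let v : ℕ → P := fun i => if h : i < n then e.symm ⟨i, h⟩ else Classical.arbitrary P
  have hv : ∀ i (hi : i < n), e (v i) = ⟨i, hi⟩ := by
    intro i hi
    simp only [v, dif_pos hi, RelIso.apply_symm_apply]
  have hv' : ∀ y, v (e y) = y := by
    intro y
    simp only [v, dif_pos (e y).isLt, Fin.eta, RelIso.symm_apply_apply]
  have hinj : ∀ ⦃a b⦄, a < n → b < n → v a = v b → a = b := by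
    intro a b ha hb hab
    have := congrArg e hab
    rw [hv a ha, hv b hb] at this
    exact congrArg Fin.val this
  have hbet : ∀ ⦃a b r⦄, a < n → b < n → v a ≤ v b → (a ≤ r ∧ r ≤ b ∨ b ≤ r ∧ r ≤ a) →
      v a ≤ v r ∧ v r ≤ v b := by
    intro a b r ha hb hab hr
    refine IsTypeA.between e hab ?_
    rw [hv a ha, hv b hb, hv r (by omega)]
    exact hr
  refine ⟨v, ⟨hinj, ?_, hbet, ?_⟩, fun y => ⟨e y, (e y).isLt, hv' y⟩⟩
  · intro i hi
    have : (SimpleGraph.hasse P).Adj (v i) (v (i + 1)) := by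
      rw [← e.map_adj_iff, hv i (by omega), hv (i + 1) hi, SimpleGraph.pathGraph_adj]
      exact Or.inl rfl
    exact this.imp (fun h => h.le) (fun h => h.le)
  · intro a b z ha hb haz hzb
    refine ⟨e z, ?_, hv' z⟩
    obtain ⟨c, hc, rfl⟩ : ∃ c, c < n ∧ v c = z := ⟨e z, (e z).isLt, hv' z⟩
    rw [hv c hc]
    change a ≤ c ∧ c ≤ b ∨ b ≤ c ∧ c ≤ a
    by_contra hcon
    have hab := haz.trans hzb
    -- If `c` lay outside the range, an endpoint would lie between `c` and the other endpoint, and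
    -- `hbet` with antisymmetry would identify it with `v c`.
    rcases (show (a ≤ b ∧ c < a ∨ b ≤ a ∧ a < c) ∨ (a ≤ b ∧ b < c ∨ b ≤ a ∧ c < b) by omega)
      with h | h
    · have := (hbet hc hb hzb (r := a) (by omega)).1
      have := hinj ha hc (le_antisymm haz this)
      omega
    · have := (hbet ha hc haz (r := b) (by omega)).2
      have := hinj hb hc (le_antisymm this hzb)
      omega

end TypeA

/-! ### Recognition of the posets `C_{m,l}` -/

section PosetC

variable {P : Type w} [PartialOrder P]

/-- An enumeration of the left chain of `C_{m,l}`, endpoints included. -/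
def PosetC.left (m l i : ℕ) : PosetC m l :=
  if i = 0 then ⊥ else if h : i - 1 < m then ((Sum.inl ⟨i - 1, h⟩ : Fin m ⊕ Fin l) :
    WithTop (Fin m ⊕ Fin l)) else (⊤ : WithTop (Fin m ⊕ Fin l))

/-- An enumeration of the right chain of `C_{m,l}`, endpoints included. -/
def PosetC.right (m l j : ℕ) : PosetC m l :=
  if j = 0 then ⊥ else if h : j - 1 < l then ((Sum.inr ⟨j - 1, h⟩ : Fin m ⊕ Fin l) :
    WithTop (Fin m ⊕ Fin l)) else (⊤ : WithTop (Fin m ⊕ Fin l))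

lemma PosetC.isDiamond (m l : ℕ) : IsDiamond (left m l) (right m l) (m + 1) (l + 1) where
  pos_left := Nat.succ_pos _
  pos_right := Nat.succ_pos _
  bot_eq := rfl
  top_eq := by simp [left, right]
  left_le_iff _ _ hi hj := by
    unfold left
    split_ifs <;> simp [-WithBot.coe_top] <;> omega
  right_le_iff _ _ hi hj := by
    unfold right
    split_ifs <;> simp [-WithBot.coe_top] <;> omega
  left_le_right_iff _ _ hi hj := by
    unfold left right
    split_ifs <;> simp [-WithBot.coe_top] <;> omega
  right_le_left_iff _ _ hi hj := by
    unfold left right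
    split_ifs <;> simp [-WithBot.coe_top] <;> omega
  cover y := by
    induction y using WithBot.recBotCoe with
    | bot => exact Or.inl ⟨0, Nat.zero_le _, rfl⟩
    | coe y =>
      induction y using WithTop.recTopCoe with
      | top => exact Or.inl ⟨m + 1, le_rfl, by simp [left]⟩
      | coe y =>
        rcases y with i | j
        · exact Or.inl ⟨i + 1, by omega, by simp [left]⟩
        · exact Or.inr ⟨j + 1, by omega, by simp [right]⟩

lemma IsDiamond.map {Q : Type*} [PartialOrder Q] {a b : ℕ → Q} {m l : ℕ}
    (h : IsDiamond a b m l) (e : Q ≃o P) : IsDiamond (e ∘ a) (e ∘ b) m l where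
  pos_left := h.pos_left
  pos_right := h.pos_right
  bot_eq := congrArg e h.bot_eq
  top_eq := congrArg e h.top_eq
  left_le_iff _ _ hi hj := e.le_iff_le.trans (h.left_le_iff hi hj)
  right_le_iff _ _ hi hj := e.le_iff_le.trans (h.right_le_iff hi hj)
  left_le_right_iff _ _ hi hj := e.le_iff_le.trans (h.left_le_right_iff hi hj)
  right_le_left_iff _ _ hi hj := e.le_iff_le.trans (h.right_le_left_iff hi hj)
  cover y := (h.cover (e.symm y)).imp
    (fun ⟨i, hi, hiy⟩ => ⟨i, hi, e.eq_symm_apply.1 hiy⟩)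
    (fun ⟨i, hi, hiy⟩ => ⟨i, hi, e.eq_symm_apply.1 hiy⟩)

/-- Recognition of `C_{m,l}`: a bounded poset whose interior is the union of two chains without
relations between them. -/
lemma exists_orderIso_posetC [Finite P] {s t : P} {A B : Set P} (hs : ∀ y, s ≤ y)
    (ht : ∀ y, y ≤ t) (hst : s ≠ t) (hA : IsChain (· ≤ ·) A) (hB : IsChain (· ≤ ·) B)
    (hsA : s ∉ A) (htA : t ∉ A) (hsB : s ∉ B) (htB : t ∉ B)
    (hAB : ∀ x ∈ A, ∀ y ∈ B, ¬ x ≤ y ∧ ¬ y ≤ x) (hcov : ∀ y, y = s ∨ y = t ∨ y ∈ A ∨ y ∈ B) :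
    Nonempty (P ≃o PosetC A.ncard B.ncard) := by
  classical
  cases nonempty_fintype P
  have henum : ∀ {S : Set P}, IsChain (· ≤ ·) S → Nonempty (Fin S.ncard ≃o S) := by
    intro S hS
    let _ : LinearOrder S := hS.linearOrder
    exact ⟨monoEquivOfFin S (Set.fintypeCard_eq_ncard S)⟩
  obtain ⟨a⟩ := henum hA
  obtain ⟨b⟩ := henum hB
  have hts : ¬ t ≤ s := fun h => hst (le_antisymm (hs t) h)
  let g : PosetC A.ncard B.ncard → P := WithBot.recBotCoe s
    (WithTop.recTopCoe t (Sum.elim (fun i => (a i : P)) (fun j => (b j : P))))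
  have hg : ∀ x y, g x ≤ g y ↔ x ≤ y := by
    intro x y
    have hns : ∀ z, z ≠ s → ¬ z ≤ s := fun z hz h => hz (le_antisymm h (hs z))
    have hnt : ∀ z, z ≠ t → ¬ t ≤ z := fun z hz h => hz (le_antisymm (ht z) h)
    have ha1 : ∀ i, ¬ (a i : P) ≤ s := fun i => hns _ fun h => hsA (h ▸ (a i).2)
    have ha2 : ∀ i, ¬ t ≤ (a i : P) := fun i => hnt _ fun h => htA (h ▸ (a i).2)
    have hb1 : ∀ i, ¬ (b i : P) ≤ s := fun i => hns _ fun h => hsB (h ▸ (b i).2)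
    have hb2 : ∀ i, ¬ t ≤ (b i : P) := fun i => hnt _ fun h => htB (h ▸ (b i).2)
    have hab : ∀ i j, ¬ (a i : P) ≤ b j := fun i j => (hAB _ (a i).2 _ (b j).2).1
    have hba : ∀ i j, ¬ (b j : P) ≤ a i := fun i j => (hAB _ (a i).2 _ (b j).2).2
    induction x using WithBot.recBotCoe with
    | bot => simp [g, hs]
    | coe x =>
      induction y using WithBot.recBotCoe with
      | bot =>
        induction x using WithTop.recTopCoe with
        | top => simp [g, hts, -WithBot.coe_top]
        | coe x => rcases x with i | i <;> simp [g, ha1, hb1]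
      | coe y =>
        rw [WithBot.coe_le_coe]
        induction y using WithTop.recTopCoe with
        | top => simp [g, ht, -WithBot.coe_top]
        | coe y =>
          induction x using WithTop.recTopCoe with
          | top => rcases y with i | i <;> simp [g, ha2, hb2, -WithBot.coe_top]
          | coe x =>
            rw [WithTop.coe_le_coe]
            rcases x with i | i <;> rcases y with j | j <;> simp [g, hab, hba]
  have hsurj : Function.Surjective g := by
    intro y
    rcases hcov y with rfl | rfl | h | h
    · exact ⟨⊥, rfl⟩
    · exact ⟨((⊤ : WithTop (Fin A.ncard ⊕ Fin B.ncard)) : PosetC A.ncard B.ncard), rfl⟩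
    · exact ⟨((Sum.inl (a.symm ⟨y, h⟩) : Fin A.ncard ⊕ Fin B.ncard) :
        WithTop (Fin A.ncard ⊕ Fin B.ncard)), congrArg Subtype.val (a.apply_symm_apply ⟨y, h⟩)⟩
    · exact ⟨((Sum.inr (b.symm ⟨y, h⟩) : Fin A.ncard ⊕ Fin B.ncard) :
        WithTop (Fin A.ncard ⊕ Fin B.ncard)), congrArg Subtype.val (b.apply_symm_apply ⟨y, h⟩)⟩
  exact ⟨(RelIso.ofSurjective (OrderEmbedding.ofMapLEIff g hg) hsurj).symm⟩

lemma PosetC.card (m l : ℕ) : Nat.card (PosetC m l) = m + l + 2 := by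
  rw [Nat.card_eq_fintype_card]
  change Fintype.card (Option (Option (Fin m ⊕ Fin l))) = _
  simp

/-- If the Hasse diagram is `2`-regular and the two lower covers of a maximal element have a common
lower bound, then the poset is of the form `C_{m,l}`. -/
theorem exists_orderIso_posetC_of_two_regular [Finite P] (hP : (SimpleGraph.hasse P).Connected)
    (hdeg : ∀ x, ((SimpleGraph.hasse P).neighborSet x).ncard = 2) {t d d' y₀ : P}
    (hd : d ⋖ t) (hd' : d' ⋖ t) (hne : d ≠ d') (hcov : ∀ y, y < t → y ≤ d ∨ y ≤ d')
    (hy₀ : y₀ ≤ d) (hy₀' : y₀ ≤ d') :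
    ∃ m l : ℕ, 0 < m ∧ 0 < l ∧ Nonempty (P ≃o PosetC m l) := by
  -- A maximal common lower bound of `d` and `d'` will be the global minimum.
  obtain ⟨s, ⟨hsd, hsd'⟩, hsmax⟩ := Set.Finite.exists_maximal
    (Set.toFinite {y : P | y ≤ d ∧ y ≤ d'}) ⟨y₀, hy₀, hy₀'⟩
  have hsmax' : ∀ y, s < y → ¬ (y ≤ d ∧ y ≤ d') := fun y hy h =>
    hy.not_ge (hsmax h hy.le)
  have hlt : s < d := lt_of_le_of_ne hsd fun h => hne (by
    by_contra
    exact hd.2 (lt_of_le_of_ne (h ▸ hsd') hne) hd'.lt)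
  have hlt' : s < d' := lt_of_le_of_ne hsd' fun h => hne (by
    by_contra
    exact hd'.2 (lt_of_le_of_ne (h ▸ hsd) hne.symm) hd.lt)
  have hst : s < t := hlt.trans hd.lt
  have hnb : ∀ {y a b c : P}, (SimpleGraph.hasse P).Adj y a → (SimpleGraph.hasse P).Adj y b →
      a ≠ b → (SimpleGraph.hasse P).Adj y c → c = a ∨ c = b := fun ha hb hab hc =>
    SimpleGraph.eq_or_eq_of_ncard_le_two (hdeg _).le ha hb hab hc
  -- The segment from `s` to `t` already contains two neighbours of each of its points, hence all of
  -- them; by connectedness it is the whole poset.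
  have hclosed : ∀ y z, (SimpleGraph.hasse P).Adj y z → s ≤ y ∧ y ≤ t → s ≤ z ∧ z ≤ t := by
    rintro y z hyz ⟨hsy, hyt⟩
    rcases hyt.eq_or_lt with rfl | hyt
    · rcases hnb (Or.inr hd) (Or.inr hd') hne hyz with rfl | rfl
      · exact ⟨hsd, hd.le⟩
      · exact ⟨hsd', hd'.le⟩
    rcases hsy.eq_or_lt with rfl | hsy
    · obtain ⟨e, he, hed⟩ := exists_covBy_le_of_lt hlt
      obtain ⟨e', he', hed'⟩ := exists_covBy_le_of_lt hlt'
      have hee : e ≠ e' := by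
        rintro rfl
        exact hsmax' e he.lt ⟨hed, hed'⟩
      rcases hnb (Or.inl he) (Or.inl he') hee hyz with rfl | rfl
      · exact ⟨he.le, hed.trans hd.le⟩
      · exact ⟨he'.le, hed'.trans hd'.le⟩
    · obtain ⟨e, hse, hey⟩ := exists_le_covBy_of_lt hsy
      obtain ⟨e', hye, het⟩ := exists_covBy_le_of_lt hyt
      rcases hnb (Or.inr hey) (Or.inl hye) (hey.lt.trans hye.lt).ne hyz with rfl | rfl
      · exact ⟨hse, hey.le.trans hyt.le⟩
      · exact ⟨hsy.le.trans hye.le, het⟩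
  have hall : ∀ y, s ≤ y ∧ y ≤ t := by
    intro y
    obtain ⟨p⟩ := hP.preconnected s y
    suffices ∀ {x z : P}, (SimpleGraph.hasse P).Walk x z → s ≤ x ∧ x ≤ t → s ≤ z ∧ z ≤ t from
      this p ⟨le_rfl, hst.le⟩
    intro x z p
    induction p with
    | nil => exact id
    | cons h p ih => exact fun hx => ih (hclosed _ _ h hx)
  have hchain : ∀ {c : P}, c < t → IsChain (· ≤ ·) {y | s < y ∧ y ≤ c} := by
    rintro c hct y ⟨hsy, hyc⟩ z ⟨hsz, hzc⟩ -
    obtain ⟨w, ⟨hyw, hzw, hwc⟩, hwmin⟩ := Set.Finite.exists_minimal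
      (Set.toFinite {w : P | y ≤ w ∧ z ≤ w ∧ w ≤ c}) ⟨c, hyc, hzc, le_rfl⟩
    rcases hyw.eq_or_lt with rfl | hyw
    · exact Or.inr hzw
    rcases hzw.eq_or_lt with rfl | hzw
    · exact Or.inl hyw.le
    -- A minimal upper bound `w` strictly above `y` and `z` has an upper cover, hence a single lower
    -- cover, which would be a smaller upper bound.
    obtain ⟨e, hye, hew⟩ := exists_le_covBy_of_lt hyw
    obtain ⟨e', hze, hew'⟩ := exists_le_covBy_of_lt hzw
    obtain ⟨f, hwf, -⟩ := exists_covBy_le_of_lt (hwc.trans_lt hct)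
    rcases hnb (Or.inr hew) (Or.inl hwf) (hew.lt.trans hwf.lt).ne (Or.inr hew') with rfl | rfl
    · exact absurd (hwmin ⟨hye, hze, hew.le.trans hwc⟩ hew.le) hew.lt.not_ge
    · exact absurd hwf.lt hew'.lt.not_gt
  have hinc : ∀ x ∈ {y | s < y ∧ y ≤ d}, ∀ y ∈ {y | s < y ∧ y ≤ d'}, ¬ x ≤ y ∧ ¬ y ≤ x :=
    fun x hx y hy => ⟨fun h => hsmax' x hx.1 ⟨hx.2, h.trans hy.2⟩,
      fun h => hsmax' y hy.1 ⟨h.trans hx.2, hy.2⟩⟩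
  refine ⟨_, _, ?_, ?_, exists_orderIso_posetC (A := {y | s < y ∧ y ≤ d})
    (B := {y | s < y ∧ y ≤ d'}) (fun y => (hall y).1) (fun y => (hall y).2) hst.ne
    (hchain hd.lt) (hchain hd'.lt) (fun h => h.1.false) (fun h => h.2.not_gt hd.lt)
    (fun h => h.1.false) (fun h => h.2.not_gt hd'.lt) hinc ?_⟩
  · exact (Set.ncard_pos).2 ⟨d, hlt, le_rfl⟩
  · exact (Set.ncard_pos).2 ⟨d', hlt', le_rfl⟩
  · intro y
    rcases (hall y).2.eq_or_lt with h | h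
    · exact Or.inr (Or.inl h)
    rcases (hall y).1.eq_or_lt with h' | h'
    · exact Or.inl h'.symm
    exact Or.inr (Or.inr ((hcov y h).imp (fun h => ⟨h', h⟩) (fun h => ⟨h', h⟩)))

end PosetC

/-! ### The classification -/

section Classification

open PosetRep

variable {P : Type w} [PartialOrder P] [Finite P]

/-- If all representations are interval-decomposable, the poset belongs to the list. -/
theorem isTypeA_or_orderIso_posetC_of_intervalDecomposable (k : Type u) [Field k]
    (hP : (SimpleGraph.hasse P).Connected) {n : ℕ} (hn : Nat.card P = n)
    (h : ∀ M : PosetRep k P, IntervalDecomposable k P M) :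
    IsTypeA P n ∨ ∃ m l : ℕ, 0 < m ∧ 0 < l ∧ m + l + 2 = n ∧ Nonempty (P ≃o PosetC m l) := by
  have hdeg : ∀ x, ((SimpleGraph.hasse P).neighborSet x).ncard ≤ 2 := by
    intro x
    by_contra hx
    obtain ⟨a, b, c, ha, hb, hc, hab, hac, hbc⟩ := (Set.two_lt_ncard_iff).1 (not_le.1 hx)
    obtain ⟨M, hM⟩ := exists_not_intervalDecomposable_of_three_neighbors k (x := x)
      (c := ![a, b, c])
      (by
        intro i j hij
        fin_cases i <;> fin_cases j <;> simp_all)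
      (by
        intro i
        fin_cases i
        · exact Or.symm ha
        · exact Or.symm hb
        · exact Or.symm hc)
    exact hM (h M)
  by_cases hleaf : ∃ v, ((SimpleGraph.hasse P).neighborSet v).ncard ≤ 1
  · obtain ⟨v, hv⟩ := hleaf
    exact Or.inl (hP.nonempty_iso_pathGraph hdeg hv hn)
  push Not at hleaf
  have hdeg2 : ∀ x, ((SimpleGraph.hasse P).neighborSet x).ncard = 2 := fun x =>
    le_antisymm (hdeg x) (hleaf x)
  right
  have := hP.nonempty
  obtain ⟨t, -, ht⟩ := Set.Finite.exists_maximal (Set.toFinite (Set.univ : Set P))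
    Set.univ_nonempty
  have htmax : ∀ y, t ≤ y → y = t := fun y hy => le_antisymm (ht trivial hy) hy
  obtain ⟨d, d', hne, hdd⟩ := Set.ncard_eq_two.1 (hdeg2 t)
  have hlower : ∀ c, c ∈ (SimpleGraph.hasse P).neighborSet t ↔ c ⋖ t := fun c =>
    ⟨fun hc => Or.resolve_left hc fun hc => hc.lt.ne' (htmax c hc.le), Or.inr⟩
  have hd : d ⋖ t := (hlower d).1 (by rw [hdd]; simp)
  have hd' : d' ⋖ t := (hlower d').1 (by rw [hdd]; simp)
  have hcov : ∀ y, y < t → y ≤ d ∨ y ≤ d' := by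
    intro y hy
    obtain ⟨c, hyc, hct⟩ := exists_le_covBy_of_lt hy
    have := (hlower c).2 hct
    rw [hdd] at this
    rcases this with rfl | rfl
    · exact Or.inl hyc
    · exact Or.inr hyc
  by_cases hlb : ∃ y, y ≤ d ∧ y ≤ d'
  · obtain ⟨y, hy, hy'⟩ := hlb
    obtain ⟨m, l, hm, hl, ⟨e⟩⟩ :=
      exists_orderIso_posetC_of_two_regular hP hdeg2 hd hd' hne hcov hy hy'
    refine ⟨m, l, hm, hl, ?_, ⟨e⟩⟩
    rw [← hn, Nat.card_congr e.toEquiv, PosetC.card]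
  -- Without a common lower bound the cycle has monodromy: in a 2-regular graph, deleting an edge
  -- does not disconnect its ends.
  · push Not at hlb
    have hcyc : (SimpleGraph.hasse P).IsCycles := fun v _ => hdeg2 v
    obtain ⟨M, hM⟩ := exists_not_intervalDecomposable_of_monodromy k htmax hd.lt hcov hlb
      (hcyc.reachable_deleteEdges (Or.inr hd))
    exact absurd (h M) hM

/-- The representations of the posets in the list are interval-decomposable. -/
theorem intervalDecomposable_of_isTypeA_or_orderIso_posetC (k : Type u) [Field k] [Nonempty P]
    {n : ℕ}
    (h : IsTypeA P n ∨ ∃ m l : ℕ, 0 < m ∧ 0 < l ∧ m + l + 2 = n ∧ Nonempty (P ≃o PosetC m l))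
    (M : PosetRep k P) : IntervalDecomposable k P M := by
  refine intervalDecomposable_of_hasIntervalSummand (fun M hM => ?_) M
  rcases h with h | ⟨m, l, -, -, -, ⟨e⟩⟩
  · obtain ⟨v, hv, hsurj⟩ := h.exists_isZigzag
    refine hasIntervalSummand_of_zigzag hv (fun y hy => ?_) hM
    obtain ⟨i, hi, hiy⟩ := hsurj y
    exact absurd hiy (hy i hi)
  · exact hasIntervalSummand_of_diamond ((PosetC.isDiamond m l).map e.symm) hM

theorem forall_intervalDecomposable_iff (k : Type u) [Field k]
    (hP : (SimpleGraph.hasse P).Connected) {n : ℕ} (hn : Nat.card P = n) :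
    (∀ M : PosetRep k P, IntervalDecomposable k P M) ↔
      (IsTypeA P n ∨ ∃ m l : ℕ, 0 < m ∧ 0 < l ∧ m + l + 2 = n ∧ Nonempty (P ≃o PosetC m l)) :=
  have := hP.nonempty
  ⟨isTypeA_or_orderIso_posetC_of_intervalDecomposable k hP hn,
    intervalDecomposable_of_isTypeA_or_orderIso_posetC k⟩

omit [Finite P] in
theorem intervalResolutionGlobalDim_eq_zero_iff (k : Type u) [Field k] :
    intervalResolutionGlobalDim k P = 0 ↔ ∀ M : PosetRep k P, IntervalDecomposable k P M :=
  resolutionGlobalDim_eq_zero_iff _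

end Classification

theorem theorem5p1 (k : Type u₁) [Field k] (k' : Type u₂) [Field k']
    (P : Type w) [PartialOrder P] [Finite P] (hP : (SimpleGraph.hasse P).Connected)
    (n : ℕ) (hn : Nat.card P = n) :
    List.TFAE [
      ∀ M : PosetRep k P, IntervalDecomposable k P M,
      ∀ M : PosetRep k P, Indecomposable M → IsIntervalModule k M,
      intervalResolutionGlobalDim k P = 0,
      IsTypeA P n ∨ ∃ m l : ℕ, 0 < m ∧ 0 < l ∧ m + l + 2 = n ∧ Nonempty (P ≃o PosetC m l)] ∧
    ((∀ M : PosetRep k P, IntervalDecomposable k P M) ↔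
      ∀ M : PosetRep k' P, IntervalDecomposable k' P M) ∧
    ((∀ M : PosetRep k P, Indecomposable M → IsIntervalModule k M) ↔
      ∀ M : PosetRep k' P, Indecomposable M → IsIntervalModule k' M) ∧
    (intervalResolutionGlobalDim k P = 0 ↔ intervalResolutionGlobalDim k' P = 0) := by
  have hk := forall_intervalDecomposable_iff k hP hn
  have hk' := forall_intervalDecomposable_iff k' hP hn
  refine ⟨?_, hk.trans hk'.symm, ?_, ?_⟩
  · tfae_have 1 ↔ 2 := forall_intervalDecomposable_iff_indecomposable
    tfae_have 3 ↔ 1 := intervalResolutionGlobalDim_eq_zero_iff k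
    tfae_have 1 ↔ 4 := hk
    tfae_finish
  · rw [← forall_intervalDecomposable_iff_indecomposable,
      ← forall_intervalDecomposable_iff_indecomposable]
    exact hk.trans hk'.symm
  · rw [intervalResolutionGlobalDim_eq_zero_iff, intervalResolutionGlobalDim_eq_zero_iff]
    exact hk.trans hk'.symm
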